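/- Consider perfect matchings of $n$ labelled points on a circle (equivalently of $\{1,\dots,n\}$), each pair being drawn as a chord; two chords $\{a,c\}$ and $\{b,d\}$ cross if $a<b<c<d$. Labelling the points amounts to rooting the matching, that is, marking an arc between two consecutive points. A $k$-core matching is a perfect matching with exactly $k$ crossings in which every chord is involved in a crossing. The core of a perfect matching $M$ is the submatching formed by its chords involved in at least one crossing, with its points relabelled increasingly. For a $k$-core matching $K$, let $n_i(K)$ be the number of regions of $K$ (connected components of the complement of the chords in the disk) whose intersection with the circle consists of $i$ arcs; $K$ is called maximal if it maximizes the potential $\sum_{i>1}(2i-3)\,n_i(K)$ among all $k$-core matchings. Let $k\ge 1$. The number $M_k(2m)$ of perfect matchings with $k$ crossings on $2m$ points satisfies $$M_k(2m)=\frac{(2k-3)!!}{2^{k-1}\,k!\;\Gamma\big(k-\tfrac12\big)}\;m^{k-\frac32}\,4^m\,(1+o(1))\qquad(m\to\infty),$$ where $(2k-3)!!=(2k-3)(2k-5)\cdots 3\cdot 1$ and $(-1)!!=1$. Moreover, the dominant contribution comes from the maximal $k$-cores: the number of perfect matchings with $k$ crossings on $2m$ points whose core is a maximal $k$-core is $M_k(2m)\,(1+o(1))$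 as $m\to\infty$. There are exactly four (rooted) maximal $k$-core matchings if $k\ge 2$, and exactly one if $k=1$. -/

import Mathlib

/-- A (rooted) perfect matching of `n` points on a circle. The points are labelled
`0, 1, …, n - 1` counterclockwise, starting just after the root, and the matching is given by the
map that sends a point to the other endpoint of its chord, a fixed-point-free involution. -/
abbrev PerfectMatching (n : ℕ) : Type :=
  {f : Fin n → Fin n // ∀ v, f (f v) = v ∧ f v ≠ v}

namespace PerfectMatching

variable {n : ℕ}

/-- The crossings of `M`: two chords `{a, c}` and `{b, d}` cross when `a < b < c < d`, and this
crossing is recorded once, by its pair `(a, b)` of first endpoints. -/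
def crossings (M : PerfectMatching n) : Finset (Fin n × Fin n) :=
  {p : Fin n × Fin n | p.1 < p.2 ∧ p.2 < M.1 p.1 ∧ M.1 p.1 < M.1 p.2}

/-- The points whose chord is involved in at least one crossing. -/
def crossingVertices (M : PerfectMatching n) : Finset (Fin n) :=
  {v : Fin n | ∃ p ∈ M.crossings, v = p.1 ∨ v = M.1 p.1 ∨ v = p.2 ∨ v = M.1 p.2}

/-- `M` is a `k`-core matching: every chord is involved in a crossing, and there are exactly `k`
crossings. -/
def IsKCore (k : ℕ) (M : PerfectMatching n) : Prop :=
  (∀ v, v ∈ M.crossingVertices) ∧ M.crossings.card = k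

theorem partner_mem_crossingVertices (M : PerfectMatching n) {v : Fin n}
    (hv : v ∈ M.crossingVertices) : M.1 v ∈ M.crossingVertices := by
  simp only [crossingVertices, Finset.mem_filter, Finset.mem_univ, true_and] at hv ⊢
  obtain ⟨p, hp, h⟩ := hv
  refine ⟨p, hp, ?_⟩
  rcases h with rfl | rfl | rfl | rfl
  · exact Or.inr (Or.inl rfl)
  · exact Or.inl (M.2 _).1
  · exact Or.inr (Or.inr (Or.inr rfl))
  · exact Or.inr (Or.inr (Or.inl (M.2 _).1))

/-- The core of `M`: the submatching formed by the chords involved in at least one crossing, its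
points being relabelled increasingly (so that the root of `M` lies on the root arc of the core). -/
def core (M : PerfectMatching n) : PerfectMatching M.crossingVertices.card :=
  ⟨fun v =>
    (M.crossingVertices.orderIsoOfFin rfl).symm
      ⟨M.1 (M.crossingVertices.orderIsoOfFin rfl v),
        M.partner_mem_crossingVertices (M.crossingVertices.orderIsoOfFin rfl v).2⟩, by
    intro v
    constructor
    · rw [OrderIso.symm_apply_eq]
      apply Subtype.ext
      simp only [OrderIso.apply_symm_apply]
      exact (M.2 _).1
    · intro h
      have h' := congrArg (M.crossingVertices.orderIsoOfFin rfl) h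
      rw [OrderIso.apply_symm_apply] at h'
      exact (M.2 _).2 (congrArg Subtype.val h')⟩

/-- The points cut the circle into `n` arcs; arc `a` is the one that ends at point `a` in
counterclockwise direction, so arc `0` is the root arc. The chord `{v, w}` with `v < w` has the arcs
`a` with `v < a ≤ w` on one side and all others on the other side. The regions of `M` are the
connected components of the disk minus the (straight) chords, i.e. the sets of points lying on
prescribed sides of all chords; hence two arcs bound the same region iff no chord separates them. -/
def SameRegion (M : PerfectMatching n) (a b : Fin n) : Prop :=
  ∀ v, v < M.1 v → ((v < a ∧ a ≤ M.1 v) ↔ (v < b ∧ b ≤ M.1 v))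

instance (M : PerfectMatching n) (a b : Fin n) : Decidable (M.SameRegion a b) := by
  unfold SameRegion; infer_instance

/-- The regions of `M` with at least one boundary arc, each given as the set of its boundary
arcs. -/
def regions (M : PerfectMatching n) : Finset (Finset (Fin n)) :=
  Finset.univ.image fun a => Finset.univ.filter fun b => M.SameRegion a b

/-- `numRegions M i` is the number `nᵢ(M)` of regions of `M` with exactly `i` boundary arcs
(for `i ≥ 1`). -/
def numRegions (M : PerfectMatching n) (i : ℕ) : ℕ :=
  (M.regions.filter fun R => R.card = i).card

/-- The potential `∑_{i > 1} (2 i - 3) nᵢ(M)`; a region has at most `n` boundary arcs. -/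
def potential (M : PerfectMatching n) : ℕ :=
  ∑ i ∈ Finset.Icc 2 n, (2 * i - 3) * M.numRegions i

/-- A maximal `k`-core: a `k`-core matching that maximizes the potential among all `k`-core
matchings, on any number of points. -/
def IsMaximalKCore (k : ℕ) (K : PerfectMatching n) : Prop :=
  K.IsKCore k ∧ ∀ (n' : ℕ) (K' : PerfectMatching n'), K'.IsKCore k → K'.potential ≤ K.potential

end PerfectMatching

/-- The number of perfect matchings of `n` points with `k` crossings. -/
noncomputable def numMatchings (k n : ℕ) : ℕ :=
  Nat.card {M : PerfectMatching n // M.crossings.card = k}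

/-- The number of perfect matchings of `n` points with `k` crossings whose core is one of the
maximal `k`-cores. -/
noncomputable def numMatchingsMaximalCore (k n : ℕ) : ℕ :=
  Nat.card {M : PerfectMatching n // M.crossings.card = k ∧ M.core.IsMaximalKCore k}

/-! Upper bound. A matching is recovered from its Dyck word together with, for each second endpoint
`b`, the number of chords open at `b` that started later than the chord closing there. These numbers
sum to the number of crossings, so with `C_m` the Catalan number there are at most `C_m * choose (m
+ k - 1) k` matchings with `k` crossings, which is asymptotically `C_m * m ^ k / k!`
(`numMatchings_le`).

Lower bound. Start from a noncrossing matching and insert `k` times a blob, that is, two crossing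
chords with noncrossing matchings in the three arcs between their endpoints, into a slot not lying
under a crossed chord. With blobs of bounded size there are `2 m - O(1)` slots. A blob with `a`,
`b`, `c` chords in its arcs costs a factor `4 ^ (-(2 + a + b + c))`, and `∑ C_a / 4 ^ a = 2`, so one
insertion contributes `2 m * 2 ^ 3 / 16 = m`; marking the inserted crossing accounts for the
division by `k!` (`sum_mul_card_spread_le`, `exists_lower_bound`). The bounds agree to first order,
and `C_m ~ 4 ^ m * m ^ (-3/2) / √π` gives the constant.

Cores. The potential equals `2 (n - r) - g`, where `r` counts the regions with a boundary arc and
`g` those with at least two. In a core, every arc that is not the last one of its region, and also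
the last arc of the root region, ends at the first point of a crossing. Hence `n - r ≤ k - 1`, and
the potential is at most `2 k - 3` (`IsKCore.potential_le`). The matchings of the lower bound have a
core with `k` arcs on the root region, which attains this value; so maximal cores alone already give
the full asymptotics.

Equality for `k ≥ 2` forces a single big region with `k` arcs and distinct first points for distinct
crossings. The `k` arcs then cut the circle into `k` pairs of crossing chords, and only the position
of the root modulo four is free (`IsKCore.eq_maximalCoreFun`). -/

namespace PerfectMatching

/-! ### Inserting one matching into a slot of another -/

variable {n b : ℕ}

theorem involutive (M : PerfectMatching n) (v : Fin n) : M.1 (M.1 v) = v := (M.2 v).1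

theorem apply_ne (M : PerfectMatching n) (v : Fin n) : M.1 v ≠ v := (M.2 v).2

theorem injective (M : PerfectMatching n) : Function.Injective M.1 :=
  Function.LeftInverse.injective M.involutive

theorem mem_crossings {M : PerfectMatching n} {p : Fin n × Fin n} :
    p ∈ M.crossings ↔ p.1 < p.2 ∧ p.2 < M.1 p.1 ∧ M.1 p.1 < M.1 p.2 := by
  simp [crossings]

theorem mem_crossingVertices {M : PerfectMatching n} {v : Fin n} :
    v ∈ M.crossingVertices ↔
      ∃ p ∈ M.crossings, v = p.1 ∨ v = M.1 p.1 ∨ v = p.2 ∨ v = M.1 p.2 := by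
  simp [crossingVertices]

/-- The position of a point after a block of `b` points has been inserted into slot `i`, that is,
before the old point `i`. -/
def insertEquiv (n b i : ℕ) (hi : i ≤ n) : Fin n ⊕ Fin b ≃ Fin (n + b) where
  toFun := Sum.elim (fun x => ⟨if (x : ℕ) < i then x else x + b, by split <;> omega⟩)
    (fun y => ⟨i + y, by omega⟩)
  invFun z := if h : (z : ℕ) < i then .inl ⟨z, by omega⟩ else
    if h' : (z : ℕ) < i + b then .inr ⟨z - i, by omega⟩ else .inl ⟨z - b, by omega⟩
  left_inv s := by
    rcases s with x | y
    · by_cases h : (x : ℕ) < i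
      · simp [h]
      · have h1 : ¬ (x : ℕ) + b < i := by omega
        have h2 : ¬ (x : ℕ) + b < i + b := by omega
        simp [h, h1]
    · simp
  right_inv z := by
    by_cases h : (z : ℕ) < i
    · simp [h]
    · by_cases h' : (z : ℕ) < i + b
      · simp only [h, h', dite_true, dite_false, Sum.elim_inr, Fin.ext_iff]; omega
      · have h1 : ¬ (z : ℕ) - b < i := by omega
        simp only [h, h', h1, dite_false, Sum.elim_inl, Fin.ext_iff, if_false]; omega

section
variable {i : ℕ} (hi : i ≤ n)

theorem insertEquiv_inl_val (x : Fin n) :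
    (insertEquiv n b i hi (.inl x) : ℕ) = if (x : ℕ) < i then (x : ℕ) else x + b := rfl

theorem insertEquiv_inr_val (y : Fin b) : (insertEquiv n b i hi (.inr y) : ℕ) = i + y := rfl

@[simp] theorem insertEquiv_inl_lt_inl (x y : Fin n) :
    insertEquiv n b i hi (.inl x) < insertEquiv n b i hi (.inl y) ↔ x < y := by
  simp only [Fin.lt_def, insertEquiv_inl_val]; split_ifs <;> omega

@[simp] theorem insertEquiv_inr_lt_inr (x y : Fin b) :
    insertEquiv n b i hi (.inr x) < insertEquiv n b i hi (.inr y) ↔ x < y := by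
  simp only [Fin.lt_def, insertEquiv_inr_val]; omega

@[simp] theorem insertEquiv_inl_lt_inr (x : Fin n) (y : Fin b) :
    insertEquiv n b i hi (.inl x) < insertEquiv n b i hi (.inr y) ↔ (x : ℕ) < i := by
  simp only [Fin.lt_def, insertEquiv_inr_val, insertEquiv_inl_val]; split_ifs <;> omega

@[simp] theorem insertEquiv_inr_lt_inl (x : Fin n) (y : Fin b) :
    insertEquiv n b i hi (.inr y) < insertEquiv n b i hi (.inl x) ↔ i ≤ (x : ℕ) := by
  simp only [Fin.lt_def, insertEquiv_inr_val, insertEquiv_inl_val]; split_ifs <;> omega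

/-- The matching obtained from `M` by inserting the matching `B` contiguously into slot `i`. -/
def insertAt (M : PerfectMatching n) {i : ℕ} (hi : i ≤ n) (B : PerfectMatching b) :
    PerfectMatching (n + b) :=
  ⟨fun z => insertEquiv n b i hi (Sum.map M.1 B.1 ((insertEquiv n b i hi).symm z)), fun z => by
    obtain ⟨s, rfl⟩ := (insertEquiv n b i hi).surjective z
    rcases s with x | y
    · simp [M.involutive, M.apply_ne]
    · simp [B.involutive, B.apply_ne]⟩

variable (M : PerfectMatching n) (B : PerfectMatching b)

@[simp] theorem insertAt_inl (x : Fin n) :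
    (M.insertAt hi B).1 (insertEquiv n b i hi (.inl x)) = insertEquiv n b i hi (.inl (M.1 x)) := by
  simp [insertAt]

@[simp] theorem insertAt_inr (y : Fin b) :
    (M.insertAt hi B).1 (insertEquiv n b i hi (.inr y)) = insertEquiv n b i hi (.inr (B.1 y)) := by
  simp [insertAt]

theorem insertAt_inj {M M' : PerfectMatching n} {B B' : PerfectMatching b}
    (h : M.insertAt hi B = M'.insertAt hi B') : M = M' ∧ B = B' := by
  constructor
  · refine Subtype.ext (funext fun x => ?_)
    have := congrFun (congrArg Subtype.val h) (insertEquiv n b i hi (.inl x))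
    simpa using this
  · refine Subtype.ext (funext fun x => ?_)
    have := congrFun (congrArg Subtype.val h) (insertEquiv n b i hi (.inr x))
    simpa using this

/-- The block is contiguous, so both endpoints of an old chord lie outside it and no old chord
crosses a new one. -/
theorem crossings_insertAt : (M.insertAt hi B).crossings =
    (M.crossings.map (Function.Embedding.prodMap
      (Function.Embedding.inl.trans (insertEquiv n b i hi).toEmbedding)
      (Function.Embedding.inl.trans (insertEquiv n b i hi).toEmbedding))).disjUnion
    (B.crossings.map (Function.Embedding.prodMap
      (Function.Embedding.inr.trans (insertEquiv n b i hi).toEmbedding)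
      (Function.Embedding.inr.trans (insertEquiv n b i hi).toEmbedding)))
    (by
      rw [Finset.disjoint_left]
      rintro ⟨u, v⟩ h1 h2
      simp only [Finset.mem_map, Function.Embedding.coe_prodMap, Prod.exists, Prod.map_apply,
        Prod.mk.injEq, Function.Embedding.trans_apply, Equiv.coe_toEmbedding] at h1 h2
      obtain ⟨x, y, -, rfl, -⟩ := h1
      obtain ⟨x', y', -, h, -⟩ := h2
      simp at h) := by
  ext ⟨u, v⟩
  obtain ⟨s, rfl⟩ := (insertEquiv n b i hi).surjective u
  obtain ⟨t, rfl⟩ := (insertEquiv n b i hi).surjective v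
  rcases s with x | x <;> rcases t with y | y <;>
    (simp [mem_crossings, Finset.mem_map]; try (intros; omega))

theorem card_crossings_insertAt :
    (M.insertAt hi B).crossings.card = M.crossings.card + B.crossings.card := by
  rw [crossings_insertAt, Finset.card_disjUnion, Finset.card_map, Finset.card_map]

@[simp] theorem mem_crossings_insertAt_inl {x y : Fin n} :
    (insertEquiv n b i hi (.inl x), insertEquiv n b i hi (.inl y)) ∈ (M.insertAt hi B).crossings ↔
      (x, y) ∈ M.crossings := by
  simp [mem_crossings]

@[simp] theorem mem_crossings_insertAt_inr {x y : Fin b} :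
    (insertEquiv n b i hi (.inr x), insertEquiv n b i hi (.inr y)) ∈ (M.insertAt hi B).crossings ↔
      (x, y) ∈ B.crossings := by
  simp [mem_crossings]

@[simp] theorem mem_crossingVertices_insertAt_inl {x : Fin n} :
    insertEquiv n b i hi (.inl x) ∈ (M.insertAt hi B).crossingVertices ↔
      x ∈ M.crossingVertices := by
  simp [mem_crossingVertices, crossings_insertAt, or_and_right, exists_or]

@[simp] theorem mem_crossingVertices_insertAt_inr {y : Fin b} :
    insertEquiv n b i hi (.inr y) ∈ (M.insertAt hi B).crossingVertices ↔
      y ∈ B.crossingVertices := by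
  simp [mem_crossingVertices, crossings_insertAt, or_and_right, exists_or]

theorem forall_fin_insert {P : Fin (n + b) → Prop} :
    (∀ z, P z) ↔ (∀ x, P (insertEquiv n b i hi (.inl x))) ∧
      ∀ y, P (insertEquiv n b i hi (.inr y)) := by
  rw [← (insertEquiv n b i hi).forall_congr_right]; simp

theorem exists_fin_insert {P : Fin (n + b) → Prop} :
    (∃ z, P z) ↔ (∃ x, P (insertEquiv n b i hi (.inl x))) ∨
      ∃ y, P (insertEquiv n b i hi (.inr y)) := by
  rw [← (insertEquiv n b i hi).exists_congr_right]; simp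

end

theorem IsKCore.insertAt {k l : ℕ} {M : PerfectMatching n} {B : PerfectMatching b} {i : ℕ}
    (hi : i ≤ n) (hM : M.IsKCore k) (hB : B.IsKCore l) : (M.insertAt hi B).IsKCore (k + l) := by
  refine ⟨?_, by rw [card_crossings_insertAt, hM.2, hB.2]⟩
  rw [forall_fin_insert hi]
  simp only [mem_crossingVertices_insertAt_inl, mem_crossingVertices_insertAt_inr]
  exact ⟨hM.1, hB.1⟩

end PerfectMatching

/-! ### Upper bound: Dyck words and overtaking numbers -/

namespace PerfectMatching

variable {n : ℕ}

/-- The points that are the second endpoint of their chord. -/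
def closers (M : PerfectMatching n) : Finset (Fin n) := {v : Fin n | M.1 v < v}

/-- The number of chords that are open when the chord of the closer `b` is closed and that were
opened after it. -/
def overtaken (M : PerfectMatching n) (b : Fin n) : ℕ :=
  (Finset.univ.filter fun v => M.1 b < v ∧ v < b ∧ b < M.1 v).card

theorem mem_closers {M : PerfectMatching n} {v : Fin n} : v ∈ M.closers ↔ M.1 v < v := by
  simp [closers]

theorem partner_mem_closers {M : PerfectMatching n} {v : Fin n} :
    M.1 v ∈ M.closers ↔ v ∉ M.closers := by
  have := M.apply_ne v
  simp only [mem_closers, M.involutive]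
  omega

theorem card_closers (M : PerfectMatching n) : 2 * M.closers.card = n := by
  have h : M.closers.card = M.closersᶜ.card := by
    refine Finset.card_bij (fun v _ => M.1 v) (fun v hv => ?_) (fun _ _ _ _ h => M.injective h)
      (fun v hv => ⟨M.1 v, ?_, M.involutive v⟩)
    · rw [Finset.mem_compl, partner_mem_closers, not_not]; exact hv
    · rw [partner_mem_closers]; simpa using hv
  have h2 := Finset.card_add_card_compl M.closers
  rw [Fintype.card_fin] at h2
  omega

theorem overtaken_eq_zero {M : PerfectMatching n} {b : Fin n} (hb : b ∉ M.closers) :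
    M.overtaken b = 0 := by
  rw [mem_closers] at hb
  simp only [overtaken, Finset.card_eq_zero, Finset.filter_eq_empty_iff, Finset.mem_univ,
    forall_const]
  intro v h
  omega

/-- Each crossing is charged to the earlier of the two second endpoints of its chords. -/
theorem sum_overtaken (M : PerfectMatching n) :
    ∑ b ∈ M.closers, M.overtaken b = M.crossings.card := by
  rw [Finset.card_eq_sum_card_fiberwise (f := fun p => M.1 p.1) (t := M.closers)]
  · refine Finset.sum_congr rfl fun b _ => ?_
    refine Finset.card_bij (fun v _ => (M.1 b, v)) ?_ ?_ ?_
    · intro v hv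
      simp only [Finset.mem_filter, Finset.mem_univ, true_and] at hv
      simpa [mem_crossings, M.involutive] using hv
    · simp
    · rintro ⟨x, y⟩ h
      simp only [Finset.mem_filter, mem_crossings] at h
      obtain ⟨h, rfl⟩ := h
      exact ⟨y, by simpa [M.involutive] using h, by simp [M.involutive]⟩
  · intro p hp
    have := mem_crossings.1 hp
    simp only [Finset.mem_coe, mem_closers, M.involutive]
    omega

/-- If `v` were closed before `b` in `M'`, its partner there would be a closer of both matchings
below `b`, where they agree, so `v` would be closed before `b` in `M` too. -/
theorem open_of_agree {M M' : PerfectMatching n} (hc : M.closers = M'.closers) {b : Fin n}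
    (ih : ∀ c < b, M.1 c < c → M.1 c = M'.1 c) {v : Fin n} (hv : v < b) (hvb : b ≤ M.1 v) :
    b ≤ M'.1 v := by
  by_contra! hlt
  have h1 : v ∉ M'.closers := by rw [← hc, mem_closers]; omega
  have h2 : M'.1 v ∈ M.closers := by rw [hc, partner_mem_closers]; exact h1
  have h3 := ih _ hlt (mem_closers.1 h2)
  rw [M'.involutive] at h3
  have h4 : M.1 v = M'.1 v := by rw [← h3, M.involutive]; rw [h3]
  omega

theorem overtaken_eq (M : PerfectMatching n) (b : Fin n) :
    M.overtaken b = (Finset.univ.filter fun v => (v < b ∧ b ≤ M.1 v) ∧ M.1 b < v).card := by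
  unfold overtaken
  congr 1
  ext v
  simp only [Finset.mem_filter, Finset.mem_univ, true_and]
  constructor
  · omega
  · rintro ⟨⟨h1, h2⟩, h3⟩
    refine ⟨h3, h1, lt_of_le_of_ne h2 ?_⟩
    rintro rfl
    rw [M.involutive] at h3
    exact lt_irrefl _ h3

/-- A matching is determined by its closers and by the numbers of chords they overtake. -/
theorem eq_of_closers_of_overtaken {M M' : PerfectMatching n} (hc : M.closers = M'.closers)
    (ho : ∀ b, M.overtaken b = M'.overtaken b) : M = M' := by
  have key : ∀ b, M.1 b < b → M.1 b = M'.1 b := by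
    intro b
    induction b using WellFoundedLT.induction with
    | ind b ih =>
    intro hb
    have hb' : M'.1 b < b := by rw [← mem_closers, ← hc]; exact mem_closers.2 hb
    have ih' : ∀ c < b, M'.1 c < c → M'.1 c = M.1 c := fun c h1 h2 =>
      (ih c h1 (by rw [← mem_closers, hc]; exact mem_closers.2 h2)).symm
    have hopen : ∀ v, (v < b ∧ b ≤ M.1 v) ↔ (v < b ∧ b ≤ M'.1 v) := fun v =>
      ⟨fun h => ⟨h.1, open_of_agree hc ih h.1 h.2⟩,
        fun h => ⟨h.1, open_of_agree hc.symm ih' h.1 h.2⟩⟩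
    have h := ho b
    rw [overtaken_eq, overtaken_eq] at h
    simp only [hopen] at h
    have m1 := (hopen (M.1 b)).1 ⟨hb, by rw [M.involutive]⟩
    have m2 : M'.1 b < b ∧ b ≤ M'.1 (M'.1 b) := ⟨hb', by rw [M'.involutive]⟩
    by_contra hne
    -- Both matchings have the same open chords at `b`. The smaller of the two candidate partners
    -- has strictly more of them starting after it, since the larger candidate is one of these.
    rcases lt_or_gt_of_ne hne with hlt | hlt
    · refine h.not_gt (Finset.card_lt_card (Finset.ssubset_iff_of_subset ?_ |>.2
        ⟨M'.1 b, by simp [m2, hlt], by simp⟩))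
      exact Finset.monotone_filter_right _ fun v _ h => ⟨h.1, hlt.trans h.2⟩
    · refine h.not_lt (Finset.card_lt_card (Finset.ssubset_iff_of_subset ?_ |>.2
        ⟨M.1 b, by simp [m1, hlt], by simp⟩))
      exact Finset.monotone_filter_right _ fun v _ h => ⟨h.1, hlt.trans h.2⟩
  refine Subtype.ext (funext fun v => ?_)
  by_cases hv : M.1 v < v
  · exact key v hv
  · have h := key (M.1 v) (by
      rw [M.involutive]; exact lt_of_le_of_ne (not_lt.1 hv) (M.apply_ne v).symm)
    rw [M.involutive] at h
    conv_rhs => rw [h, M'.involutive]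

end PerfectMatching

theorem List.count_take_ofFn {α : Type*} [DecidableEq α] {n : ℕ} (f : Fin n → α) (a : α) (i : ℕ) :
    ((List.ofFn f).take i).count a =
      (Finset.univ.filter fun v : Fin n => (v : ℕ) < i ∧ f v = a).card := by
  induction i with
  | zero => simp
  | succ i ih =>
    rw [List.take_add_one, List.count_append, ih]
    by_cases hi : i < n
    · have hs : (Finset.univ.filter fun v : Fin n => (v : ℕ) < i + 1 ∧ f v = a) =
          (Finset.univ.filter fun v : Fin n => (v : ℕ) < i ∧ f v = a) ∪
            (if f ⟨i, hi⟩ = a then {⟨i, hi⟩} else ∅) := by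
        ext v
        simp only [Finset.mem_filter, Finset.mem_univ, true_and, Finset.mem_union]
        by_cases hv : v = ⟨i, hi⟩
        · subst hv; split_ifs with h <;> simp [h]
        · have : (v : ℕ) ≠ i := fun h => hv (Fin.ext h)
          have h2 : (v : ℕ) < i + 1 ↔ (v : ℕ) < i := by omega
          split_ifs <;> simp [hv, h2]
      rw [hs, Finset.card_union_of_disjoint]
      · congr 1
        simp only [List.getElem?_ofFn, hi, dite_true, Option.toList_some, List.count_singleton']
        split_ifs <;> simp_all
      · rw [Finset.disjoint_left]
        intro v hv
        simp only [Finset.mem_filter] at hv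
        split_ifs
        · rw [Finset.mem_singleton]; rintro rfl; simp at hv
        · simp
    · simp only [List.getElem?_ofFn, hi, dite_false, Option.toList_none, List.count_nil, add_zero]
      congr 1
      ext v
      have := v.2
      simp only [Finset.mem_filter, Finset.mem_univ, true_and]
      constructor <;> rintro ⟨_, h⟩ <;> exact ⟨by omega, h⟩

namespace PerfectMatching

/-- The Dyck word of a matching: up at the first endpoint of a chord, down at the second one. -/
def dyckWord {n : ℕ} (M : PerfectMatching n) : DyckWord where
  toList := List.ofFn fun v => if M.1 v < v then DyckStep.D else DyckStep.U
  count_U_eq_count_D := by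
    have h := fun s => List.count_take_ofFn
      (fun v => if M.1 v < v then DyckStep.D else DyckStep.U) s n
    rw [List.take_of_length_le (by simp)] at h
    rw [h, h]
    symm
    refine Finset.card_bij (fun v _ => M.1 v) (fun v hv => ?_) (fun _ _ _ _ h => M.injective h)
      (fun v hv => ⟨M.1 v, ?_, M.involutive v⟩)
    · simp only [Finset.mem_filter, Fin.is_lt, Finset.mem_univ, true_and, M.involutive] at hv ⊢
      split_ifs at hv ⊢ with h1 h2
      · omega
      · rfl
    · have := M.apply_ne v
      simp only [Finset.mem_filter, Fin.is_lt, Finset.mem_univ, true_and, M.involutive] at hv ⊢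
      split_ifs at hv ⊢ with h1 h2
      · rfl
      · omega
  count_D_le_count_U i := by
    rw [List.count_take_ofFn, List.count_take_ofFn]
    -- The partner of a down step is an earlier up step.
    refine Finset.card_le_card_of_injOn M.1 (fun v hv => ?_) M.injective.injOn
    simp only [Finset.coe_filter, Set.mem_ofPred_eq, Finset.mem_univ, true_and, M.involutive]
      at hv ⊢
    by_cases h1 : M.1 v < v
    · rw [if_neg h1.not_gt]
      exact ⟨by omega, rfl⟩
    · simp [h1] at hv

theorem closers_eq_of_dyckWord_eq {n : ℕ} {M M' : PerfectMatching n}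
    (h : M.dyckWord = M'.dyckWord) : M.closers = M'.closers := by
  have h1 := List.ofFn_injective (congrArg DyckWord.toList h)
  ext v
  have h2 := congrFun h1 v
  rw [mem_closers, mem_closers]
  by_cases h3 : M.1 v < v <;> by_cases h4 : M'.1 v < v <;> simp [h3, h4] at h2 ⊢

theorem semilength_dyckWord {m : ℕ} (M : PerfectMatching (2 * m)) : M.dyckWord.semilength = m := by
  have h := M.dyckWord.two_mul_semilength_eq_length
  simp only [dyckWord, List.length_ofFn] at h ⊢
  omega

end PerfectMatching

open PerfectMatching in
/-- An upper bound for the number of matchings with `k` crossings, which is sharp to first order. -/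
theorem numMatchings_le (k m : ℕ) :
    numMatchings k (2 * m) ≤ catalan m * (m + k - 1).choose k := by
  classical
  rw [numMatchings, Nat.card_eq_fintype_card, Fintype.card_subtype, mul_comm (catalan m)]
  refine (Finset.card_le_mul_card_image (f := fun M : PerfectMatching (2 * m) =>
    (⟨M.dyckWord, M.semilength_dyckWord⟩ : {p : DyckWord // p.semilength = m})) _ _ ?_).trans
    (Nat.mul_le_mul_left _ ((Finset.card_le_univ _).trans
      (DyckWord.card_dyckWord_semilength_eq_catalan m).le))
  intro w hw
  obtain ⟨M₀, -, rfl⟩ := Finset.mem_image.1 hw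
  have h0 := M₀.card_closers
  -- All matchings in the fibre of a Dyck word share the same `m` closers, so their overtaking
  -- numbers are ways of writing `k` as a sum of `m` natural numbers.
  have hcard := Finset.card_finsuppAntidiag_nat_eq_choose (s := M₀.closers) k
  rw [show M₀.closers.card = m by omega] at hcard
  rw [← hcard]
  refine Finset.card_le_card_of_injOn (fun M => Finsupp.equivFunOnFinite.symm M.overtaken) ?_ ?_
  · intro M hM
    simp only [Finset.coe_filter, Set.mem_ofPred_eq, Finset.mem_filter, Finset.mem_univ, true_and,
      Subtype.mk.injEq] at hM
    have hc := closers_eq_of_dyckWord_eq hM.2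
    rw [Finset.mem_coe, Finset.mem_finsuppAntidiag]
    refine ⟨?_, fun b hb => ?_⟩
    · rw [← hc, ← hM.1, ← sum_overtaken]; rfl
    · by_contra hb'
      rw [← hc] at hb'
      exact (Finsupp.mem_support_iff.1 hb) (overtaken_eq_zero hb')
  · intro M hM M' hM' h
    simp only [Finset.coe_filter, Set.mem_ofPred_eq, Finset.mem_filter, Finset.mem_univ, true_and,
      Subtype.mk.injEq] at hM hM'
    exact eq_of_closers_of_overtaken (closers_eq_of_dyckWord_eq (hM.2.trans hM'.2.symm))
      fun b => congrFun (Finsupp.equivFunOnFinite.symm.injective h) b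

/-! ### Lower bound: inserting crossing pairs into noncrossing matchings -/

namespace PerfectMatching

variable {n b : ℕ}

section
variable {i : ℕ} (hi : i ≤ n)

@[simp] theorem insertEquiv_inl_le_inl (x y : Fin n) :
    insertEquiv n b i hi (.inl x) ≤ insertEquiv n b i hi (.inl y) ↔ x ≤ y := by
  simp only [← not_lt, insertEquiv_inl_lt_inl]

@[simp] theorem insertEquiv_inr_le_inr (x y : Fin b) :
    insertEquiv n b i hi (.inr x) ≤ insertEquiv n b i hi (.inr y) ↔ x ≤ y := by
  simp only [← not_lt, insertEquiv_inr_lt_inr]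

@[simp] theorem insertEquiv_inl_le_inr (x : Fin n) (y : Fin b) :
    insertEquiv n b i hi (.inl x) ≤ insertEquiv n b i hi (.inr y) ↔ (x : ℕ) < i := by
  simp only [← not_lt, insertEquiv_inr_lt_inl]; rw [not_not]

@[simp] theorem insertEquiv_inr_le_inl (x : Fin n) (y : Fin b) :
    insertEquiv n b i hi (.inr y) ≤ insertEquiv n b i hi (.inl x) ↔ i ≤ (x : ℕ) := by
  rw [← not_lt, insertEquiv_inl_lt_inr, not_lt]

end

/-- Slot `i` lies under a chord involved in a crossing. -/
def IsCovered (M : PerfectMatching n) (i : ℕ) : Prop :=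
  ∃ v ∈ M.crossingVertices, (v : ℕ) < i ∧ i ≤ (M.1 v : ℕ)

instance (M : PerfectMatching n) (i : ℕ) : Decidable (M.IsCovered i) := by
  unfold IsCovered; infer_instance

theorem isCovered_val {M : PerfectMatching n} {a : Fin n} :
    M.IsCovered a ↔ ∃ v ∈ M.crossingVertices, v < a ∧ a ≤ M.1 v := Iff.rfl

theorem not_isCovered_zero (M : PerfectMatching n) : ¬ M.IsCovered 0 := by
  simp [IsCovered]

/-- The points lying under a chord involved in a crossing. -/
def covered (M : PerfectMatching n) : Finset (Fin n) := {a : Fin n | M.IsCovered a}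

/-- The points of chords involved in a crossing that do not lie under such a chord. -/
def exposed (M : PerfectMatching n) : Finset (Fin n) :=
  M.crossingVertices.filter fun a => ¬ M.IsCovered a

theorem mem_exposed {M : PerfectMatching n} {a : Fin n} :
    a ∈ M.exposed ↔ a ∈ M.crossingVertices ∧ ¬ M.IsCovered a := by
  simp [exposed]

section
variable {i : ℕ} (hi : i ≤ n) (M : PerfectMatching n) (B : PerfectMatching b)

theorem isCovered_insertAt_inl (x : Fin n) :
    (M.insertAt hi B).IsCovered (insertEquiv n b i hi (.inl x)) ↔ M.IsCovered x := by
  rw [isCovered_val, isCovered_val, exists_fin_insert hi]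
  simp only [mem_crossingVertices_insertAt_inl, insertEquiv_inl_lt_inl, insertAt_inl,
    insertEquiv_inl_le_inl, mem_crossingVertices_insertAt_inr, insertEquiv_inr_lt_inl, insertAt_inr,
    insertEquiv_inl_le_inr, or_iff_left_iff_imp]
  rintro ⟨y, -, h1, h2⟩
  omega

theorem isCovered_insertAt_inr (y : Fin b) :
    (M.insertAt hi B).IsCovered (insertEquiv n b i hi (.inr y)) ↔
      M.IsCovered i ∨ B.IsCovered y := by
  rw [isCovered_val, isCovered_val, exists_fin_insert hi]
  simp [IsCovered]

theorem card_covered_insertAt_le :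
    (M.insertAt hi B).covered.card ≤ M.covered.card + b := by
  have h : (M.insertAt hi B).covered ⊆
      (M.covered.image fun x => insertEquiv n b i hi (.inl x)) ∪
        Finset.univ.image fun y => insertEquiv n b i hi (.inr y) := by
    intro z
    revert z
    rw [forall_fin_insert hi]
    simp only [covered, Finset.mem_filter, Finset.mem_univ, true_and, isCovered_insertAt_inl,
      Finset.mem_union, Finset.mem_image]
    exact ⟨fun x hx => Or.inl ⟨x, hx, rfl⟩, fun y _ => Or.inr ⟨y, rfl⟩⟩
  refine (Finset.card_le_card h).trans ((Finset.card_union_le _ _).trans ?_)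
  refine add_le_add Finset.card_image_le (Finset.card_image_le.trans ?_)
  simp

/-- A slot that is not covered puts no crossed chord over the block, so exposed points of the block
stay exposed; old points are covered exactly as before. -/
theorem card_exposed_insertAt (hM : ¬ M.IsCovered i) :
    (M.insertAt hi B).exposed.card = M.exposed.card + B.exposed.card := by
  have h : (M.insertAt hi B).exposed =
      (M.exposed.disjSum B.exposed).map (insertEquiv n b i hi).toEmbedding := by
    ext z
    revert z
    rw [forall_fin_insert hi]
    simp [mem_exposed, isCovered_insertAt_inl, isCovered_insertAt_inr, hM]
  rw [h, Finset.card_map, Finset.card_disjSum]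

end

/-- The matching of two points. -/
def chord : PerfectMatching 2 := ⟨![1, 0], by decide⟩

/-- The matching formed by two crossing chords. -/
def cross : PerfectMatching 4 := ⟨![2, 3, 0, 1], by decide⟩

theorem card_crossings_chord : chord.crossings.card = 0 := by decide

theorem card_crossings_cross : cross.crossings.card = 1 := by decide

theorem cross_isKCore : cross.IsKCore 1 := by
  constructor <;> decide

/-- The noncrossing matchings. -/
def noncrossing (n : ℕ) : Finset (PerfectMatching n) := {M | M.crossings.card = 0}

theorem mem_noncrossing {M : PerfectMatching n} : M ∈ noncrossing n ↔ M.crossings.card = 0 := by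
  simp [noncrossing]

/-- First-return decomposition: one matching goes under the chord of point `0`, the other to its
right. -/
theorem card_noncrossing_mul_le {a b N : ℕ} (hN : 0 < N) (h : N = 2 * b + 2 + 2 * a) :
    (noncrossing (2 * a)).card * (noncrossing (2 * b)).card ≤
      ((noncrossing N).filter fun M => (M.1 ⟨0, hN⟩ : ℕ) = 2 * a + 1).card := by
  subst h
  have hi : 1 ≤ 2 * b + 2 := by omega
  rw [← Finset.card_product]
  refine Finset.card_le_card_of_injOn
    (fun P => (P.2.insertAt (Nat.zero_le _) chord).insertAt hi P.1) ?_ ?_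
  · rintro ⟨A, B⟩ h
    simp only [Finset.coe_product, Set.mem_prod, Finset.mem_coe, mem_noncrossing] at h
    rw [Finset.mem_coe, Finset.mem_filter, mem_noncrossing]
    refine ⟨by simp only [card_crossings_insertAt, card_crossings_chord, h], ?_⟩
    have h0 : (⟨0, hN⟩ : Fin (2 * b + 2 + 2 * a)) = insertEquiv _ _ 1 hi
        (.inl (insertEquiv (2 * b) 2 0 (Nat.zero_le _) (.inr 0))) := by
      simp [Fin.ext_iff, insertEquiv_inl_val, insertEquiv_inr_val]
    rw [h0, insertAt_inl, insertAt_inr]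
    simp [insertEquiv_inl_val, insertEquiv_inr_val, chord, add_comm]
  · rintro ⟨A, B⟩ - ⟨A', B'⟩ - h
    obtain ⟨h1, rfl⟩ := insertAt_inj _ h
    obtain ⟨rfl, -⟩ := insertAt_inj _ h1
    rfl

/-- The Catalan recursion, summed over the disjoint classes given by the partner of point `0`. Only
this inequality is needed for the lower bound. -/
theorem catalan_le_card_noncrossing (m : ℕ) : catalan m ≤ (noncrossing (2 * m)).card := by
  induction m using Nat.strong_induction_on with
  | _ m ih =>
  rcases m with _ | m
  · rw [catalan_zero]
    exact Finset.card_pos.2 ⟨⟨fun v => v, fun v => v.elim0⟩, by rw [mem_noncrossing]; decide⟩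
  · rw [catalan_succ']
    calc ∑ ij ∈ Finset.HasAntidiagonal.antidiagonal m, catalan ij.1 * catalan ij.2
        ≤ ∑ ij ∈ Finset.HasAntidiagonal.antidiagonal m, ((noncrossing (2 * (m + 1))).filter fun M =>
            ((M.1 ⟨0, by omega⟩ : ℕ) - 1) / 2 = ij.1).card := by
          refine Finset.sum_le_sum fun ij h => ?_
          obtain ⟨a, b⟩ := ij
          rw [Finset.HasAntidiagonal.mem_antidiagonal] at h
          subst h
          refine (Nat.mul_le_mul (ih _ (by dsimp; omega)) (ih _ (by dsimp; omega))).trans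
            ((card_noncrossing_mul_le (by omega) (by ring)).trans (Finset.card_le_card ?_))
          refine Finset.monotone_filter_right _ fun M _ h => ?_
          rw [h]; dsimp; omega
      _ ≤ (noncrossing (2 * (m + 1))).card := by
          rw [Finset.Nat.sum_antidiagonal_eq_sum_range_succ_mk]
          rw [Finset.sum_card_fiberwise_eq_card_filter]
          exact Finset.card_filter_le _ _

/-- Two crossing chords with matchings inserted into the three arcs between their endpoints. -/
def blob {a b c : ℕ} (A : PerfectMatching a) (B : PerfectMatching b) (C : PerfectMatching c) :
    PerfectMatching (4 + c + b + a) :=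
  ((cross.insertAt (i := 3) (by omega) C).insertAt (i := 2) (by omega) B).insertAt (i := 1)
    (by omega) A

/-- The position in a blob of the points of its two crossing chords. -/
def blobPoint (a b c : ℕ) (x : Fin 4) : Fin (4 + c + b + a) :=
  insertEquiv _ _ 1 (by omega) (.inl (insertEquiv _ _ 2 (by omega)
    (.inl (insertEquiv _ _ 3 (by omega) (.inl x)))))

section
variable {a b c : ℕ} (A : PerfectMatching a) (B : PerfectMatching b) (C : PerfectMatching c)

theorem blob_blobPoint (x : Fin 4) :
    (blob A B C).1 (blobPoint a b c x) = blobPoint a b c (cross.1 x) := by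
  simp [blob, blobPoint]

theorem blobPoint_zero : (blobPoint a b c 0 : ℕ) = 0 := by
  simp [blobPoint, insertEquiv_inl_val]

theorem blobPoint_one : (blobPoint a b c 1 : ℕ) = 1 + a := by
  simp [blobPoint, insertEquiv_inl_val]

theorem blobPoint_two : (blobPoint a b c 2 : ℕ) = 2 + b + a := by
  simp [blobPoint, insertEquiv_inl_val]

theorem blobPoint_three : (blobPoint a b c 3 : ℕ) = 3 + c + b + a := by
  have h : ((3 : Fin 4) : ℕ) = 3 := rfl
  simp only [blobPoint, insertEquiv_inl_val, h]
  split_ifs <;> omega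

theorem blobPoint_mem_crossings :
    (blobPoint a b c 0, blobPoint a b c 1) ∈ (blob A B C).crossings := by
  simp only [blob, blobPoint, mem_crossings_insertAt_inl]
  decide

theorem card_crossings_blob (hA : A.crossings.card = 0) (hB : B.crossings.card = 0)
    (hC : C.crossings.card = 0) : (blob A B C).crossings.card = 1 := by
  simp only [blob, card_crossings_insertAt, card_crossings_cross, hA, hB, hC]

theorem one_le_card_exposed_blob : 1 ≤ (blob A B C).exposed.card := by
  refine Finset.card_pos.2 ⟨blobPoint a b c 0, mem_exposed.2 ⟨?_, ?_⟩⟩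
  · exact mem_crossingVertices.2 ⟨_, blobPoint_mem_crossings A B C, Or.inl rfl⟩
  · rw [blobPoint_zero]; exact not_isCovered_zero _

theorem blob_inj {A A' : PerfectMatching a} {B B' : PerfectMatching b} {C C' : PerfectMatching c}
    (h : blob A B C = blob A' B' C') : A = A' ∧ B = B' ∧ C = C' := by
  obtain ⟨h1, hA⟩ := insertAt_inj _ h
  obtain ⟨h2, hB⟩ := insertAt_inj _ h1
  exact ⟨hA, hB, (insertAt_inj _ h2).2⟩

end

/-- The matchings with `k` crossings, at least `k` exposed points and few covered points. -/
def spread (L k n : ℕ) : Finset (PerfectMatching n) :=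
  {M | M.crossings.card = k ∧ k ≤ M.exposed.card ∧ M.covered.card ≤ L * k}

theorem mem_spread {L k : ℕ} {M : PerfectMatching n} : M ∈ spread L k n ↔
    M.crossings.card = k ∧ k ≤ M.exposed.card ∧ M.covered.card ≤ L * k := by
  simp [spread]

theorem insertAt_mem_spread {L k i : ℕ} {M : PerfectMatching n} {B : PerfectMatching b}
    (hM : M ∈ spread L k n) (hi : i ≤ n) (hc : ¬ M.IsCovered i) (hB : B.crossings.card = 1)
    (hE : 1 ≤ B.exposed.card) (hb : b ≤ L) : M.insertAt hi B ∈ spread L (k + 1) (n + b) := by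
  rw [mem_spread] at hM ⊢
  refine ⟨by rw [card_crossings_insertAt, hM.1, hB], ?_, ?_⟩
  · rw [card_exposed_insertAt hi M B hc]; omega
  · refine (card_covered_insertAt_le hi M B).trans ?_
    rw [mul_add, mul_one]; omega

/-- The matchings in `spread` with a marked crossing. -/
def markedSpread (L k n : ℕ) : Finset (Σ _ : PerfectMatching n, Fin n × Fin n) :=
  (spread L k n).sigma fun M => M.crossings

theorem card_markedSpread (L k n : ℕ) : (markedSpread L k n).card = k * (spread L k n).card := by
  rw [markedSpread, Finset.card_sigma, Finset.sum_congr rfl fun M hM => (mem_spread.1 hM).1,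
    Finset.sum_const, smul_eq_mul, mul_comm]

/-- The numbers of points in the three arcs of a marked crossing. -/
def arcSizes (P : Σ _ : PerfectMatching n, Fin n × Fin n) : ℕ × ℕ × ℕ :=
  ((P.2.2 : ℕ) - P.2.1 - 1, (P.1.1 P.2.1 : ℕ) - P.2.2 - 1, (P.1.1 P.2.2 : ℕ) - P.1.1 P.2.1 - 1)

/-- Insertion of a blob can be undone once its crossing is marked: the first marked point gives the
slot, and the arc sizes give the extent of the blob. Since at most `L * k` points are covered, at
least `n - L * k` slots are available. -/
theorem mul_card_spread_le_card_markedSpread {L k n a b c N : ℕ} (h : N = n + (4 + c + b + a))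
    (hL : 4 + c + b + a ≤ L) :
    (noncrossing a).card * ((noncrossing b).card * (noncrossing c).card) *
        ((n - L * k) * (spread L k n).card) ≤
      ((markedSpread L (k + 1) N).filter fun P => arcSizes P = (a, b, c)).card := by
  classical
  subst h
  have h1 : (n - L * k) * (spread L k n).card ≤
      ((spread L k n).sigma fun M => M.coveredᶜ).card := by
    rw [Finset.card_sigma, mul_comm, ← smul_eq_mul]
    refine Finset.card_nsmul_le_sum _ _ _ fun M hM => ?_
    have := (mem_spread.1 hM).2.2
    rw [Finset.card_compl, Fintype.card_fin]
    omega
  refine (Nat.mul_le_mul_left _ h1).trans ?_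
  rw [← Finset.card_product, ← Finset.card_product, ← Finset.card_product]
  refine Finset.card_le_card_of_injOn
    (fun P => ⟨P.2.1.insertAt P.2.2.is_lt.le (blob P.1.1 P.1.2.1 P.1.2.2),
      insertEquiv _ _ _ P.2.2.is_lt.le (.inr (blobPoint a b c 0)),
      insertEquiv _ _ _ P.2.2.is_lt.le (.inr (blobPoint a b c 1))⟩) ?_ ?_
  · rintro ⟨⟨A, B, C⟩, M, i⟩ hP
    simp only [Finset.coe_product, Set.mem_prod, Finset.mem_coe, mem_noncrossing,
      Finset.mem_sigma, Finset.mem_compl, covered, Finset.mem_filter, Finset.mem_univ,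
      true_and] at hP
    obtain ⟨⟨hA, hB, hC⟩, hM, hi⟩ := hP
    rw [Finset.mem_coe, Finset.mem_filter]
    refine ⟨?_, ?_⟩
    · rw [markedSpread, Finset.mem_sigma]
      exact ⟨insertAt_mem_spread hM _ hi (card_crossings_blob A B C hA hB hC)
        (one_le_card_exposed_blob A B C) hL,
        (mem_crossings_insertAt_inr _ _ _).2 (blobPoint_mem_crossings A B C)⟩
    · have e0 : cross.1 0 = 2 := rfl
      have e1 : cross.1 1 = 3 := rfl
      simp only [arcSizes, insertAt_inr, blob_blobPoint, insertEquiv_inr_val, blobPoint_zero,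
        blobPoint_one, blobPoint_two, blobPoint_three, e0, e1, Prod.mk.injEq]
      omega
  · rintro ⟨⟨A, B, C⟩, M, i⟩ - ⟨⟨A', B', C'⟩, M', i'⟩ - h
    simp only [Sigma.mk.injEq, heq_eq_eq, Prod.mk.injEq] at h
    obtain ⟨h1, h2, -⟩ := h
    have hi : i = i' := by
      have := congrArg Fin.val h2
      simp only [insertEquiv_inr_val, blobPoint_zero] at this
      exact Fin.ext this
    subst hi
    obtain ⟨rfl, h3⟩ := insertAt_inj _ h1
    obtain ⟨rfl, rfl, rfl⟩ := blob_inj h3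
    rfl

/-- The classes for different arc sizes are disjoint, and each matching is counted once per marked
crossing, hence the factor `k + 1`. With fewer than `L` chords in each arc a blob has at most `6 * L
+ 4` points. -/
theorem sum_mul_card_spread_le (L k m : ℕ) (hm : 3 * L + 2 ≤ m) :
    ∑ t ∈ Finset.range L ×ˢ Finset.range L ×ˢ Finset.range L,
      catalan t.1 * (catalan t.2.1 * catalan t.2.2) *
        ((2 * (m - (2 + t.1 + t.2.1 + t.2.2)) - (6 * L + 4) * k) *
          (spread (6 * L + 4) k (2 * (m - (2 + t.1 + t.2.1 + t.2.2)))).card) ≤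
      (k + 1) * (spread (6 * L + 4) (k + 1) (2 * m)).card := by
  rw [← card_markedSpread]
  calc _ ≤ ∑ t ∈ Finset.range L ×ˢ Finset.range L ×ˢ Finset.range L,
        ((markedSpread (6 * L + 4) (k + 1) (2 * m)).filter fun P =>
          (fun s : ℕ × ℕ × ℕ => (s.1 / 2, s.2.1 / 2, s.2.2 / 2)) (arcSizes P) = t).card := by
        refine Finset.sum_le_sum fun t ht => ?_
        obtain ⟨a, b, c⟩ := t
        simp only [Finset.mem_product, Finset.mem_range] at ht
        dsimp only
        refine (Nat.mul_le_mul_right _ (Nat.mul_le_mul (catalan_le_card_noncrossing a)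
          (Nat.mul_le_mul (catalan_le_card_noncrossing b) (catalan_le_card_noncrossing c)))).trans ?_
        refine (mul_card_spread_le_card_markedSpread (N := 2 * m) (by omega) (by omega)).trans ?_
        refine Finset.card_le_card (Finset.monotone_filter_right _ fun P _ h => ?_)
        simp [h]
    _ ≤ _ := by
        rw [Finset.sum_card_fiberwise_eq_card_filter]
        exact Finset.card_filter_le _ _

theorem catalan_le_card_spread_zero (L m : ℕ) : catalan m ≤ (spread L 0 (2 * m)).card := by
  refine (catalan_le_card_noncrossing m).trans (Finset.card_le_card fun M hM => ?_)
  rw [mem_noncrossing, Finset.card_eq_zero] at hM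
  rw [mem_spread]
  simp [covered, IsCovered, hM, crossingVertices]

end PerfectMatching

/-! ### Regions, the potential and its maximum; cores -/

namespace PerfectMatching

variable {n : ℕ}

theorem SameRegion.refl (M : PerfectMatching n) (a : Fin n) : M.SameRegion a a := fun _ _ => Iff.rfl

theorem SameRegion.symm {M : PerfectMatching n} {a b : Fin n} (h : M.SameRegion a b) :
    M.SameRegion b a := fun v hv => (h v hv).symm

theorem SameRegion.trans {M : PerfectMatching n} {a b c : Fin n} (h : M.SameRegion a b)
    (h' : M.SameRegion b c) : M.SameRegion a c := fun v hv => (h v hv).trans (h' v hv)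

/-- The boundary arcs of the region of arc `a`. -/
def region (M : PerfectMatching n) (a : Fin n) : Finset (Fin n) :=
  Finset.univ.filter fun b => M.SameRegion a b

theorem mem_region {M : PerfectMatching n} {a b : Fin n} : b ∈ M.region a ↔ M.SameRegion a b := by
  simp [region]

theorem self_mem_region (M : PerfectMatching n) (a : Fin n) : a ∈ M.region a :=
  mem_region.2 (SameRegion.refl M a)

theorem region_eq_iff {M : PerfectMatching n} {a b : Fin n} :
    M.region a = M.region b ↔ M.SameRegion a b := by
  refine ⟨fun h => ?_, fun h => ?_⟩
  · rw [← mem_region, h]; exact M.self_mem_region b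
  · ext c
    rw [mem_region, mem_region]
    exact ⟨fun h' => h.symm.trans h', fun h' => h.trans h'⟩

theorem regions_eq_image (M : PerfectMatching n) : M.regions = Finset.univ.image M.region := rfl

theorem region_mem_regions (M : PerfectMatching n) (a : Fin n) : M.region a ∈ M.regions :=
  Finset.mem_image_of_mem _ (Finset.mem_univ a)

theorem sum_card_regions (M : PerfectMatching n) : ∑ R ∈ M.regions, R.card = n := by
  conv_rhs => rw [← Fintype.card_fin n, ← Finset.card_univ,
    Finset.card_eq_sum_card_image M.region, ← regions_eq_image]
  refine Finset.sum_congr rfl fun R hR => ?_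
  rw [regions_eq_image, Finset.mem_image] at hR
  obtain ⟨a, -, rfl⟩ := hR
  congr 1
  ext b
  simp only [Finset.mem_filter, Finset.mem_univ, true_and, mem_region, region_eq_iff]
  exact ⟨SameRegion.symm, SameRegion.symm⟩

/-- The regions with at least two boundary arcs. -/
def bigRegions (M : PerfectMatching n) : Finset (Finset (Fin n)) :=
  M.regions.filter fun R => 2 ≤ R.card

theorem potential_eq_sum (M : PerfectMatching n) :
    M.potential = ∑ R ∈ M.bigRegions, (2 * R.card - 3) := by
  rw [potential, ← Finset.sum_fiberwise_of_maps_to (s := M.bigRegions) (t := Finset.Icc 2 n)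
    (g := Finset.card)]
  · refine Finset.sum_congr rfl fun i hi => ?_
    rw [numRegions, mul_comm, ← smul_eq_mul, ← Finset.sum_const]
    refine Finset.sum_congr ?_ fun R hR => ?_
    · ext R
      simp only [Finset.mem_filter, bigRegions]
      constructor
      · rintro ⟨h1, rfl⟩; exact ⟨⟨h1, (Finset.mem_Icc.1 hi).1⟩, rfl⟩
      · rintro ⟨⟨h1, -⟩, h2⟩; exact ⟨h1, h2⟩
    · rw [(Finset.mem_filter.1 hR).2]
  · intro R hR
    rw [Finset.mem_Icc]
    exact ⟨(Finset.mem_filter.1 hR).2, by simpa using Finset.card_le_univ R⟩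

theorem card_pos_of_mem_regions {M : PerfectMatching n} {R : Finset (Fin n)} (hR : R ∈ M.regions) :
    1 ≤ R.card := by
  rw [regions_eq_image, Finset.mem_image] at hR
  obtain ⟨a, -, rfl⟩ := hR
  exact Finset.card_pos.2 ⟨a, M.self_mem_region a⟩

/-- A big region contributes `2 |R| - 3 = 2 (|R| - 1) - 1`, and `|R| - 1` vanishes on the other
regions, so the sum of `2 (|R| - 1)` may run over all of them. -/
theorem potential_add (M : PerfectMatching n) :
    M.potential + M.bigRegions.card + 2 * M.regions.card = 2 * n := by
  have h1 : M.potential + M.bigRegions.card = ∑ R ∈ M.bigRegions, 2 * (R.card - 1) := by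
    rw [potential_eq_sum, Finset.card_eq_sum_ones, ← Finset.sum_add_distrib]
    refine Finset.sum_congr rfl fun R hR => ?_
    have := (Finset.mem_filter.1 hR).2
    omega
  have h2 : ∑ R ∈ M.bigRegions, 2 * (R.card - 1) = ∑ R ∈ M.regions, 2 * (R.card - 1) := by
    refine Finset.sum_subset (Finset.filter_subset _ _) fun R hR hR' => ?_
    have : ¬ 2 ≤ R.card := fun h => hR' (Finset.mem_filter.2 ⟨hR, h⟩)
    omega
  rw [h1, h2, Finset.card_eq_sum_ones, Finset.mul_sum, ← Finset.sum_add_distrib]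
  conv_rhs => rw [← M.sum_card_regions, Finset.mul_sum]
  refine Finset.sum_congr rfl fun R hR => ?_
  have := card_pos_of_mem_regions hR
  omega

theorem le_potential {M : PerfectMatching n} {S : Finset (Fin n)} {k : ℕ} (hk : 2 ≤ k)
    (hS : k ≤ S.card) (h : ∀ a ∈ S, ∀ b ∈ S, M.SameRegion a b) : 2 * k - 3 ≤ M.potential := by
  obtain ⟨a, ha⟩ : S.Nonempty := Finset.card_pos.1 (by omega)
  have hle : S.card ≤ (M.region a).card :=
    Finset.card_le_card fun b hb => mem_region.2 (h a ha b hb)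
  rw [potential_eq_sum]
  have hmem : M.region a ∈ M.bigRegions :=
    Finset.mem_filter.2 ⟨M.region_mem_regions a, by omega⟩
  refine le_trans ?_ (Finset.single_le_sum (f := fun R : Finset (Fin n) => 2 * R.card - 3)
    (fun _ _ => Nat.zero_le _) hmem)
  omega

/-- The arcs that are not the last one of their region. -/
def nonlast (M : PerfectMatching n) : Finset (Fin n) :=
  Finset.univ.filter fun a => ∃ b, a < b ∧ M.SameRegion a b

theorem mem_nonlast {M : PerfectMatching n} {a : Fin n} :
    a ∈ M.nonlast ↔ ∃ b, a < b ∧ M.SameRegion a b := by simp [nonlast]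

theorem exists_last (M : PerfectMatching n) (a : Fin n) :
    ∃ z, z ∉ M.nonlast ∧ M.SameRegion a z := by
  have hne : (M.region a).Nonempty := ⟨a, M.self_mem_region a⟩
  refine ⟨(M.region a).max' hne, ?_, mem_region.1 (Finset.max'_mem _ hne)⟩
  rw [mem_nonlast]
  rintro ⟨b, h1, h2⟩
  have h3 := mem_region.1 (Finset.max'_mem _ hne)
  exact h1.not_ge (Finset.le_max' _ _ (mem_region.2 (h3.trans h2)))

theorem card_nonlast_add (M : PerfectMatching n) : M.nonlast.card + M.regions.card = n := by
  have h : M.regions.card = M.nonlastᶜ.card := by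
    symm
    refine Finset.card_bij (fun a _ => M.region a) (fun a _ => M.region_mem_regions a) ?_ ?_
    · intro a ha b hb h
      rw [region_eq_iff] at h
      rw [Finset.mem_compl, mem_nonlast] at ha hb
      push Not at ha hb
      by_contra hne
      rcases lt_or_gt_of_ne hne with hlt | hlt
      · exact ha b hlt h
      · exact hb a hlt h.symm
    · intro R hR
      rw [regions_eq_image, Finset.mem_image] at hR
      obtain ⟨a, -, rfl⟩ := hR
      obtain ⟨z, h1, h2⟩ := M.exists_last a
      exact ⟨z, by simpa using h1, (region_eq_iff.2 h2).symm⟩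
  rw [h, Finset.card_add_card_compl, Fintype.card_fin]

/-- The points `v` with `a ≤ v < c` are matched among themselves. -/
def ClosedIco (M : PerfectMatching n) (a c : ℕ) : Prop :=
  ∀ v : Fin n, a ≤ v → (v : ℕ) < c → a ≤ (M.1 v : ℕ) ∧ (M.1 v : ℕ) < c

/-- A chord with exactly one endpoint in the interval would separate the two arcs. -/
theorem SameRegion.closedIco {M : PerfectMatching n} {a b : Fin n} (h : M.SameRegion a b) :
    M.ClosedIco a b := by
  intro v h1 h2
  have hv := h v
  have hv' := h (M.1 v)
  rw [M.involutive] at hv'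
  simp only [Fin.lt_def, Fin.le_def] at hv hv'
  by_contra hcon
  have := Fin.val_ne_of_ne (M.apply_ne v)
  by_cases hlt : (v : ℕ) < (M.1 v : ℕ)
  · have := hv hlt; omega
  · have := hv' (by omega); omega

/-- The root arc lies under no chord, hence neither does arc `z`, and no chord starting before `z`
ends at or after it. -/
theorem closedIco_of_sameRegion_zero {M : PerfectMatching n} {o z : Fin n} (ho : (o : ℕ) = 0)
    (h : M.SameRegion o z) : M.ClosedIco z n := by
  intro v h1 h2
  refine ⟨?_, (M.1 v).is_lt⟩
  have hv' := h (M.1 v)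
  rw [M.involutive] at hv'
  simp only [Fin.lt_def, Fin.le_def] at hv'
  by_contra hlt
  have := hv' (by omega)
  omega

/-- The first points of the crossings. -/
def firsts (M : PerfectMatching n) : Finset (Fin n) := M.crossings.image Prod.fst

theorem card_firsts_le (M : PerfectMatching n) : M.firsts.card ≤ M.crossings.card :=
  Finset.card_image_le

theorem mem_firsts {M : PerfectMatching n} {a : Fin n} :
    a ∈ M.firsts ↔ ∃ q, (a, q) ∈ M.crossings := by
  simp [firsts]

/-- A closed block contains, with a chord, every chord crossing it. So all four endpoints of a
crossing at `a` are in the block, and `a`, being its least point, is the first of them. -/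
theorem ClosedIco.mem_firsts {M : PerfectMatching n} {a : Fin n} {c : ℕ}
    (hM : a ∈ M.crossingVertices) (hac : (a : ℕ) < c) (h : M.ClosedIco a c) : a ∈ M.firsts := by
  obtain ⟨⟨p, q⟩, hpq, hv⟩ := mem_crossingVertices.1 hM
  have hc := mem_crossings.1 hpq
  simp only [Fin.lt_def] at hc hv
  have ha := h a le_rfl hac
  rcases hv with rfl | rfl | rfl | rfl
  · exact PerfectMatching.mem_firsts.2 ⟨q, hpq⟩
  · rw [M.involutive] at ha; omega
  · have := h (M.1 p) (by omega) (by omega)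
    rw [M.involutive] at this; omega
  · rw [M.involutive] at ha; omega

/-- In a core, the arcs that are not the last one of their region, together with the last arc of
the root region, all end at the first point of a crossing. -/
theorem insert_nonlast_subset_firsts {M : PerfectMatching n} (hM : ∀ v, v ∈ M.crossingVertices)
    {o z : Fin n} (ho : (o : ℕ) = 0) (hz : M.SameRegion o z) :
    insert z M.nonlast ⊆ M.firsts := by
  intro a ha
  rcases Finset.mem_insert.1 ha with rfl | ha
  · exact (closedIco_of_sameRegion_zero ho hz).mem_firsts (hM _) a.is_lt
  · obtain ⟨b, h1, h2⟩ := mem_nonlast.1 ha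
    exact h2.closedIco.mem_firsts (hM _) h1

theorem IsKCore.pos {k : ℕ} {M : PerfectMatching n} (hM : M.IsKCore k) (hk : 1 ≤ k) : 0 < n := by
  obtain ⟨p, -⟩ : M.crossings.Nonempty := Finset.card_pos.1 (by rw [hM.2]; omega)
  exact Fin.pos p.1

theorem IsKCore.lt_add_card_regions {k : ℕ} {M : PerfectMatching n} (hM : M.IsKCore k)
    (hk : 1 ≤ k) : n < k + M.regions.card := by
  obtain ⟨z, h1, h2⟩ := M.exists_last ⟨0, hM.pos hk⟩
  have h3 := Finset.card_le_card (insert_nonlast_subset_firsts hM.1 rfl h2)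
  rw [Finset.card_insert_of_notMem h1] at h3
  have h4 := M.card_firsts_le
  have h5 := M.card_nonlast_add
  rw [hM.2] at h4
  omega

theorem IsKCore.potential_le {k : ℕ} {M : PerfectMatching n} (hM : M.IsKCore k) (hk : 1 ≤ k) :
    M.potential ≤ 2 * k - 3 := by
  have h1 := hM.lt_add_card_regions hk
  have h2 := M.potential_add
  -- The count of regions only gives `2 * k - 2`; a big region saves one more, and without any the
  -- potential is `0`. For `k = 1` the truncated bound is `0`.
  rcases Nat.eq_zero_or_pos M.bigRegions.card with h | h
  · have : M.potential = 0 := by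
      rw [potential_eq_sum, Finset.card_eq_zero.1 h, Finset.sum_empty]
    omega
  · omega

theorem IsKCore.isMaximalKCore {k : ℕ} {M : PerfectMatching n} (hM : M.IsKCore k) (hk : 1 ≤ k)
    (h : 2 * k - 3 ≤ M.potential) : M.IsMaximalKCore k :=
  ⟨hM, fun _ _ hK' => (hK'.potential_le hk).trans h⟩

/-! ### The core of a matching -/

/-- The increasing enumeration of the points of the core. -/
def corePoint (M : PerfectMatching n) (v : Fin M.crossingVertices.card) : Fin n :=
  M.crossingVertices.orderIsoOfFin rfl v

theorem corePoint_mem (M : PerfectMatching n) (v : Fin M.crossingVertices.card) :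
    M.corePoint v ∈ M.crossingVertices := (M.crossingVertices.orderIsoOfFin rfl v).2

theorem exists_corePoint_eq {M : PerfectMatching n} {v : Fin n} (hv : v ∈ M.crossingVertices) :
    ∃ w, M.corePoint w = v :=
  ⟨(M.crossingVertices.orderIsoOfFin rfl).symm ⟨v, hv⟩, by simp [corePoint]⟩

@[simp] theorem corePoint_lt_corePoint (M : PerfectMatching n) {v w : Fin M.crossingVertices.card} :
    M.corePoint v < M.corePoint w ↔ v < w := by
  unfold corePoint
  rw [Subtype.coe_lt_coe, OrderIso.lt_iff_lt]

@[simp] theorem corePoint_le_corePoint (M : PerfectMatching n) {v w : Fin M.crossingVertices.card} :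
    M.corePoint v ≤ M.corePoint w ↔ v ≤ w := by
  rw [← not_lt, corePoint_lt_corePoint, not_lt]

theorem corePoint_injective (M : PerfectMatching n) : Function.Injective M.corePoint :=
  Subtype.val_injective.comp (OrderIso.injective _)

@[simp] theorem corePoint_core (M : PerfectMatching n) (v : Fin M.crossingVertices.card) :
    M.corePoint (M.core.1 v) = M.1 (M.corePoint v) := by
  simp [corePoint, core]

theorem mem_crossings_core {M : PerfectMatching n} {v w : Fin M.crossingVertices.card} :
    (v, w) ∈ M.core.crossings ↔ (M.corePoint v, M.corePoint w) ∈ M.crossings := by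
  simp only [mem_crossings, ← corePoint_core, corePoint_lt_corePoint]

theorem card_crossings_core (M : PerfectMatching n) :
    M.core.crossings.card = M.crossings.card := by
  refine Finset.card_bij (fun p _ => (M.corePoint p.1, M.corePoint p.2))
    (fun p hp => mem_crossings_core.1 hp) ?_ ?_
  · rintro ⟨a, b⟩ - ⟨c, d⟩ - h
    rw [Prod.mk.injEq] at h
    exact Prod.ext (M.corePoint_injective h.1) (M.corePoint_injective h.2)
  · rintro ⟨a, b⟩ h
    obtain ⟨v, rfl⟩ := exists_corePoint_eq (M := M) (v := a)
      (mem_crossingVertices.2 ⟨_, h, Or.inl rfl⟩)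
    obtain ⟨w, rfl⟩ := exists_corePoint_eq (M := M) (v := b)
      (mem_crossingVertices.2 ⟨_, h, Or.inr (Or.inr (Or.inl rfl))⟩)
    exact ⟨(v, w), mem_crossings_core.2 h, rfl⟩

theorem core_isKCore (M : PerfectMatching n) : M.core.IsKCore M.crossings.card := by
  refine ⟨fun v => ?_, M.card_crossings_core⟩
  obtain ⟨⟨a, b⟩, h, hv⟩ := mem_crossingVertices.1 (M.corePoint_mem v)
  obtain ⟨x, rfl⟩ := exists_corePoint_eq (M := M) (v := a)
    (mem_crossingVertices.2 ⟨_, h, Or.inl rfl⟩)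
  obtain ⟨y, rfl⟩ := exists_corePoint_eq (M := M) (v := b)
    (mem_crossingVertices.2 ⟨_, h, Or.inr (Or.inr (Or.inl rfl))⟩)
  simp only [← corePoint_core, M.corePoint_injective.eq_iff] at hv
  exact mem_crossingVertices.2 ⟨(x, y), mem_crossings_core.2 h, hv⟩

/-- Arcs of the core that end at exposed points lie under no chord of the core, so all of them bound
the root region. -/
theorem sameRegion_core_of_exposed {M : PerfectMatching n} {a b : Fin M.crossingVertices.card}
    (ha : M.corePoint a ∈ M.exposed) (hb : M.corePoint b ∈ M.exposed) :
    M.core.SameRegion a b := by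
  have key : ∀ c, M.corePoint c ∈ M.exposed → ∀ v, ¬ (v < c ∧ c ≤ M.core.1 v) := by
    intro c hc v hv
    refine (mem_exposed.1 hc).2 (isCovered_val.2 ⟨M.corePoint v, M.corePoint_mem v, ?_⟩)
    rwa [← corePoint_core, corePoint_lt_corePoint, corePoint_le_corePoint]
  intro v _
  simp only [key a ha v, key b hb v]

theorem isMaximalKCore_core_of_exposed {M : PerfectMatching n} {k : ℕ} (hk : 1 ≤ k)
    (hM : M.crossings.card = k) (hE : k ≤ M.exposed.card) : M.core.IsMaximalKCore k := by
  refine (hM ▸ M.core_isKCore).isMaximalKCore hk ?_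
  rcases hk.eq_or_lt with rfl | hk2
  · simp
  · refine le_potential (S := Finset.univ.filter fun v => M.corePoint v ∈ M.exposed) hk2 ?_
      fun a ha b hb => sameRegion_core_of_exposed (by simpa using ha) (by simpa using hb)
    refine hE.trans (Finset.card_le_card_of_surjOn M.corePoint fun v hv => ?_)
    obtain ⟨w, rfl⟩ := exists_corePoint_eq (M := M) (mem_exposed.1 hv).1
    exact ⟨w, by simpa using hv, rfl⟩

end PerfectMatching

open PerfectMatching in
theorem card_spread_le {k : ℕ} (hk : 1 ≤ k) (L n : ℕ) :
    (spread L k n).card ≤ numMatchingsMaximalCore k n := by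
  classical
  rw [numMatchingsMaximalCore, Nat.card_eq_fintype_card, Fintype.card_subtype]
  refine Finset.card_le_card fun M hM => ?_
  rw [mem_spread] at hM
  simp only [Finset.mem_filter, Finset.mem_univ, true_and]
  exact ⟨hM.1, isMaximalKCore_core_of_exposed hk hM.1 hM.2.1⟩

theorem numMatchingsMaximalCore_le (k n : ℕ) : numMatchingsMaximalCore k n ≤ numMatchings k n := by
  unfold numMatchingsMaximalCore numMatchings
  exact Nat.card_le_card_of_injective (fun M => ⟨M.1, M.2.1⟩) fun M M' h => by
    simpa [Subtype.ext_iff] using h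

/-! ### Rigidity of cores of maximal potential -/

namespace PerfectMatching

variable {n : ℕ}

/-- If a set of points of a core is closed under the matching and under crossings and contains only
one first point of a crossing, and the crossings are determined by their first points, then the set
consists of the endpoints of two crossing chords. -/
theorem exists_crossing_of_unique_first {M : PerfectMatching n} (hM : ∀ v, v ∈ M.crossingVertices)
    (hinj : Set.InjOn Prod.fst (M.crossings : Set (Fin n × Fin n))) {S : Set (Fin n)}
    (hS : ∀ v ∈ S, M.1 v ∈ S) (hcr : ∀ p ∈ M.crossings, p.1 ∈ S ↔ p.2 ∈ S) {z : Fin n}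
    (hz : z ∈ S) (hf : ∀ p ∈ M.firsts, p ∈ S → p = z) (hzf : z ∈ M.firsts) :
    ∃ q ∈ S, z < q ∧ q < M.1 z ∧ M.1 z < M.1 q ∧
      ∀ v ∈ S, v = z ∨ v = q ∨ v = M.1 z ∨ v = M.1 q := by
  obtain ⟨q, hq⟩ := mem_firsts.1 hzf
  have hc := mem_crossings.1 hq
  refine ⟨q, (hcr _ hq).1 hz, hc.1, hc.2.1, hc.2.2, fun v hv => ?_⟩
  obtain ⟨⟨p', q'⟩, hp, hv'⟩ := mem_crossingVertices.1 (hM v)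
  have hp' : p' ∈ S := by
    rcases hv' with rfl | rfl | rfl | rfl
    · exact hv
    · simpa [M.involutive] using hS _ hv
    · exact (hcr _ hp).2 hv
    · exact (hcr _ hp).2 (by simpa [M.involutive] using hS _ hv)
  have h1 : p' = z := hf _ (mem_firsts.2 ⟨q', hp⟩) hp'
  subst h1
  have h2 : q' = q := congrArg Prod.snd (hinj hp hq rfl)
  subst h2
  dsimp only at hv'
  tauto

theorem ClosedIco.crossing_iff {M : PerfectMatching n} {a c : ℕ} (h : M.ClosedIco a c)
    {p : Fin n × Fin n} (hp : p ∈ M.crossings) :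
    (a ≤ p.1 ∧ (p.1 : ℕ) < c) ↔ (a ≤ p.2 ∧ (p.2 : ℕ) < c) := by
  have hc := mem_crossings.1 hp
  simp only [Fin.lt_def] at hc
  constructor
  · rintro ⟨h1, h2⟩
    have := h _ h1 h2
    omega
  · rintro ⟨h1, h2⟩
    have := h _ h1 h2
    have := h (M.1 p.1) (by omega) (by omega)
    rwa [M.involutive] at this

theorem ClosedIco.compl {M : PerfectMatching n} {a c : ℕ} (h : M.ClosedIco a c) {v : Fin n}
    (hv : ¬ (a ≤ v ∧ (v : ℕ) < c)) : ¬ (a ≤ M.1 v ∧ (M.1 v : ℕ) < c) := by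
  rintro ⟨h1, h2⟩
  have := h _ h1 h2
  rw [M.involutive] at this
  exact hv this

/-- The single first point `a` leaves room for only one crossing in the block, and in a core its
four endpoints exhaust the block. -/
theorem ClosedIco.eq_block {M : PerfectMatching n} (hM : ∀ v, v ∈ M.crossingVertices)
    (hinj : Set.InjOn Prod.fst (M.crossings : Set (Fin n × Fin n))) {a : Fin n} {c : ℕ}
    (hc : c ≤ n) (hac : (a : ℕ) < c) (h : M.ClosedIco a c)
    (hf : ∀ p ∈ M.firsts, (a : ℕ) ≤ p → (p : ℕ) < c → p = a) :
    c = a + 4 ∧ ∀ v : Fin n, (a : ℕ) ≤ v → (v : ℕ) < c →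
      (M.1 v : ℕ) = if (v : ℕ) < a + 2 then (v : ℕ) + 2 else v - 2 := by
  obtain ⟨q, hqS, h1, h2, h3, hall⟩ := exists_crossing_of_unique_first hM hinj
    (S := {v : Fin n | (a : ℕ) ≤ v ∧ (v : ℕ) < c}) (z := a) (fun v hv => h v hv.1 hv.2)
    (fun p hp => h.crossing_iff hp) ⟨le_rfl, hac⟩ (fun p hp hp' => hf p hp hp'.1 hp'.2)
    (h.mem_firsts (hM a) hac)
  have hqS' : (a : ℕ) ≤ q ∧ (q : ℕ) < c := hqS
  have hMq := h q hqS'.1 hqS'.2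
  have hall' : ∀ v : ℕ, (a : ℕ) ≤ v → v < c →
      v = a ∨ v = q ∨ v = (M.1 a : ℕ) ∨ v = (M.1 q : ℕ) := by
    intro v hv hv'
    simpa [Fin.ext_iff] using hall ⟨v, by omega⟩ ⟨hv, hv'⟩
  simp only [Fin.lt_def] at h1 h2 h3
  have e1 := hall' (a + 1) (by omega) (by omega)
  have e2 := hall' (a + 2) (by omega) (by omega)
  have e3 := hall' (a + 3) (by omega) (by omega)
  have e4 : c = a + 4 := by
    by_contra hne
    have := hall' (a + 4) (by omega) (by omega)
    omega
  refine ⟨e4, fun v hv hv' => ?_⟩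
  rcases hall v ⟨hv, hv'⟩ with rfl | rfl | rfl | rfl
  · rw [if_pos (by omega)]; omega
  · rw [if_pos (by omega)]; omega
  · rw [if_neg (by omega), M.involutive]; omega
  · rw [if_neg (by omega), M.involutive]; omega

/-- The maximal `k`-core on `4 k` points whose blocks of four points start at
`s, s + 4, s + 8, …`, the last block being continued at the points below `s`. -/
def maximalCoreFun (k s x : ℕ) : ℕ :=
  if s ≤ x ∧ x < s + 4 * (k - 1) then (if (x - s) % 4 < 2 then x + 2 else x - 2)
  else
    let y := if x < s then x else x - 4 * (k - 1)
    let y' := if y < 2 then y + 2 else y - 2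
    if y' < s then y' else y' + 4 * (k - 1)

/-- The block that wraps around the root: its four points are those outside a middle interval, which
is nonempty on the right by `hT`, so at most three of them precede the interval. -/
theorem eq_maximalCoreFun_of_outer {M : PerfectMatching n} {k s : ℕ} (hT : s + 4 * (k - 1) < n)
    {z q : Fin n} (hz : ¬ (s ≤ z ∧ (z : ℕ) < s + 4 * (k - 1)))
    (hq : ¬ (s ≤ q ∧ (q : ℕ) < s + 4 * (k - 1)))
    (hMz : ¬ (s ≤ M.1 z ∧ (M.1 z : ℕ) < s + 4 * (k - 1)))
    (hMq : ¬ (s ≤ M.1 q ∧ (M.1 q : ℕ) < s + 4 * (k - 1)))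
    (h1 : z < q) (h2 : q < M.1 z) (h3 : M.1 z < M.1 q)
    (hall : ∀ v : Fin n, ¬ (s ≤ v ∧ (v : ℕ) < s + 4 * (k - 1)) →
      v = z ∨ v = q ∨ v = M.1 z ∨ v = M.1 q) :
    n = 4 * (k - 1) + 4 ∧ s < 4 ∧ ∀ v : Fin n, ¬ (s ≤ v ∧ (v : ℕ) < s + 4 * (k - 1)) →
      (M.1 v : ℕ) = maximalCoreFun k s v := by
  have hMz2 := M.involutive z
  have hMq2 := M.involutive q
  have hcard : s + (n - (s + 4 * (k - 1))) = 4 := by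
    have e1 : (Finset.univ.filter fun v : Fin n => ¬ (s ≤ v ∧ (v : ℕ) < s + 4 * (k - 1))) =
        Finset.Iio ⟨s, by omega⟩ ∪ Finset.Ici ⟨s + 4 * (k - 1), hT⟩ := by
      ext v
      simp only [Finset.mem_filter, Finset.mem_univ, true_and, Finset.mem_union, Finset.mem_Iio,
        Finset.mem_Ici, Fin.lt_def, Fin.le_def]
      omega
    have e2 : (Finset.univ.filter fun v : Fin n => ¬ (s ≤ v ∧ (v : ℕ) < s + 4 * (k - 1))) =
        {z, q, M.1 z, M.1 q} := by
      ext v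
      simp only [Finset.mem_filter, Finset.mem_univ, true_and, Finset.mem_insert,
        Finset.mem_singleton]
      refine ⟨hall v, ?_⟩
      rintro (rfl | rfl | rfl | rfl) <;> assumption
    have e3 := congrArg Finset.card (e1.symm.trans e2)
    rw [Finset.card_union_of_disjoint, Fin.card_Iio, Fin.card_Ici] at e3
    · rw [e3]
      rw [Finset.card_insert_of_notMem, Finset.card_insert_of_notMem,
        Finset.card_insert_of_notMem, Finset.card_singleton]
      · simp only [Finset.mem_singleton]; omega
      · simp only [Finset.mem_singleton, Finset.mem_insert]; omega
      · simp only [Finset.mem_singleton, Finset.mem_insert]; omega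
    · rw [Finset.disjoint_left]
      intro v hv hv'
      simp only [Finset.mem_Iio, Finset.mem_Ici, Fin.lt_def, Fin.le_def] at hv hv'
      omega
  refine ⟨by omega, by omega, fun v hv => ?_⟩
  have hall' : ∀ v : ℕ, v < n → ¬ (s ≤ v ∧ v < s + 4 * (k - 1)) →
      v = z ∨ v = q ∨ v = (M.1 z : ℕ) ∨ v = (M.1 q : ℕ) := by
    intro v hv hv'
    simpa [Fin.ext_iff] using hall ⟨v, hv⟩ hv'
  have hv2 := hall v hv
  rw [maximalCoreFun, if_neg hv]
  simp only [Fin.lt_def] at h1 h2 h3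
  have hs : s < 4 := by omega
  generalize 4 * (k - 1) = K at *
  -- The left-hand sides for `j = 0, 1, 2, 3` are the outer positions in increasing order, so they
  -- must match `z < q < M z < M q` one by one.
  have hp : ∀ j < 4, (if j < s then j else j + K) = (z : ℕ) ∨ (if j < s then j else j + K) = q ∨
      (if j < s then j else j + K) = (M.1 z : ℕ) ∨ (if j < s then j else j + K) = (M.1 q : ℕ) := by
    intro j hj
    apply hall' <;> split_ifs <;> omega
  have p0 := hp 0 (by omega)
  have p1 := hp 1 (by omega)
  have p2 := hp 2 (by omega)
  have p3 := hp 3 (by omega)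
  have q0 : (z : ℕ) = if 0 < s then 0 else 0 + K := by split_ifs at * <;> omega
  have q1 : (q : ℕ) = if 1 < s then 1 else 1 + K := by split_ifs at * <;> omega
  have q2 : (M.1 z : ℕ) = if 2 < s then 2 else 2 + K := by split_ifs at * <;> omega
  have q3 : (M.1 q : ℕ) = if 3 < s then 3 else 3 + K := by split_ifs at * <;> omega
  clear p0 p1 p2 p3 hp hall' hall hMz hMq hz hq
  rcases hv2 with rfl | rfl | rfl | rfl
  · rw [q2, q0]; dsimp only; split_ifs <;> omega
  · rw [q3, q1]; dsimp only; split_ifs <;> omega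
  · rw [hMz2, q0, q2]; dsimp only; split_ifs <;> omega
  · rw [hMq2, q1, q3]; dsimp only; split_ifs <;> omega

end PerfectMatching

/-! ### Classification and number of the maximal cores -/

namespace PerfectMatching

variable {n : ℕ}

theorem IsKCore.eq_maximalCoreFun_of_one {M : PerfectMatching n} (hM : M.IsKCore 1) :
    n = 4 * 1 ∧ ∃ s < 4, ∀ v : Fin n, (M.1 v : ℕ) = maximalCoreFun 1 s v := by
  obtain ⟨p, hp⟩ := Finset.card_eq_one.1 hM.2
  have hpm : p ∈ M.crossings := by simp [hp]
  obtain ⟨q, -, h1, h2, h3, hall⟩ := exists_crossing_of_unique_first hM.1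
    (by rw [hp]; simp) (S := Set.univ) (z := p.1) (fun _ _ => Set.mem_univ _) (by simp)
    (Set.mem_univ _) (by simp [firsts, hp]) (mem_firsts.2 ⟨p.2, hpm⟩)
  have := hM.pos le_rfl
  -- For `k = 1` the middle interval is empty and the outer block is the whole matching.
  obtain ⟨e1, e2, e3⟩ := eq_maximalCoreFun_of_outer (M := M) (k := 1) (s := 0) (by omega)
    (by omega) (by omega) (by omega) (by omega) h1 h2 h3 fun v _ => hall v (Set.mem_univ v)
  exact ⟨by omega, 0, e2, fun v => e3 v (by omega)⟩

/-- Every inequality behind `IsKCore.potential_le` becomes an equality: there is one big region `R`,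
it has `k` arcs, the first points are exactly the nonlast arcs and `z`, and each belongs to one
crossing only. Consecutive arcs of `R` then delimit blocks with a single first point. -/
theorem IsKCore.eq_maximalCoreFun {k : ℕ} {M : PerfectMatching n} (hM : M.IsKCore k) (hk : 2 ≤ k)
    (hpot : 2 * k - 3 ≤ M.potential) :
    n = 4 * k ∧ ∃ s < 4, ∀ v : Fin n, (M.1 v : ℕ) = maximalCoreFun k s v := by
  have hk1 : 1 ≤ k := by omega
  have hlt := hM.lt_add_card_regions hk1
  have hadd := M.potential_add
  have hnl := M.card_nonlast_add
  have hbig : M.bigRegions.card = 1 := by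
    have : M.bigRegions.card ≠ 0 := by
      intro h
      have : M.potential = 0 := by
        rw [potential_eq_sum, Finset.card_eq_zero.1 h, Finset.sum_empty]
      omega
    omega
  obtain ⟨R, hR⟩ := Finset.card_eq_one.1 hbig
  have hRmem : R ∈ M.bigRegions := by simp [hR]
  have hRcard : R.card = k := by
    have h1 := (hM.potential_le hk1).antisymm hpot
    rw [potential_eq_sum, hR, Finset.sum_singleton] at h1
    have := (Finset.mem_filter.1 hRmem).2
    omega
  have hregion : ∀ a b, a ≠ b → M.SameRegion a b → M.region a = R := by
    intro a b hne h
    rw [← Finset.mem_singleton, ← hR, bigRegions, Finset.mem_filter]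
    exact ⟨M.region_mem_regions a, Finset.one_lt_card.2
      ⟨a, M.self_mem_region a, b, mem_region.2 h, hne⟩⟩
  have hsame : ∀ a ∈ R, ∀ b, b ∈ R ↔ M.SameRegion a b := by
    obtain ⟨r, -, rfl⟩ := Finset.mem_image.1 (Finset.mem_filter.1 hRmem).1
    intro a ha b
    have ha' : M.SameRegion r a := mem_region.1 ha
    exact ⟨fun hb => ha'.symm.trans (mem_region.1 hb), fun hb => mem_region.2 (ha'.trans hb)⟩
  obtain ⟨z, hz1, hz2⟩ := M.exists_last ⟨0, hM.pos hk1⟩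
  have hsub := insert_nonlast_subset_firsts hM.1 rfl hz2
  have hfc := M.card_firsts_le
  rw [hM.2] at hfc
  have hfirsts : insert z M.nonlast = M.firsts := by
    refine Finset.eq_of_subset_of_card_le hsub ?_
    rw [Finset.card_insert_of_notMem hz1]
    omega
  have hinj : Set.InjOn Prod.fst (M.crossings : Set (Fin n × Fin n)) := by
    rw [← Finset.card_image_iff]
    refine le_antisymm Finset.card_image_le ?_
    have h2 := Finset.card_le_card hsub
    rw [Finset.card_insert_of_notMem hz1] at h2
    rw [hM.2]
    exact le_trans (by omega) h2
  -- Either the root region is `R`, or it has the root arc as its only arc.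
  have hz0 : z ∈ R ∨ (z : ℕ) = 0 := by
    by_cases h : z = ⟨0, hM.pos hk1⟩
    · right; rw [h]
    · left; rw [← hregion _ _ (Ne.symm h) hz2]; exact mem_region.2 hz2
  have hnlR : ∀ p ∈ M.nonlast, p ∈ R ∧ ∃ b ∈ R, p < b := by
    intro p hp
    obtain ⟨b, h1, h2⟩ := mem_nonlast.1 hp
    have := hregion p b h1.ne h2
    exact ⟨this ▸ M.self_mem_region p, b, this ▸ mem_region.2 h2, h1⟩
  let a := R.orderEmbOfFin hRcard
  have haR : ∀ j, a j ∈ R := fun j => R.orderEmbOfFin_mem hRcard j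
  have hRa : ∀ v ∈ R, ∃ j, a j = v := by
    intro v hv
    have : v ∈ Set.range (R.orderEmbOfFin hRcard) := by rw [Finset.range_orderEmbOfFin]; exact hv
    exact this
  have hblock : ∀ j (hj : j + 1 < k), (a ⟨j + 1, hj⟩ : ℕ) = a ⟨j, by omega⟩ + 4 ∧
      ∀ v : Fin n, (a ⟨j, by omega⟩ : ℕ) ≤ v → (v : ℕ) < a ⟨j + 1, hj⟩ →
        (M.1 v : ℕ) = if (v : ℕ) < a ⟨j, by omega⟩ + 2 then (v : ℕ) + 2 else v - 2 := by
    intro j hj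
    have hlt' : a ⟨j, by omega⟩ < a ⟨j + 1, hj⟩ := a.strictMono (by simp [Fin.lt_def])
    refine ClosedIco.eq_block hM.1 hinj (a ⟨j + 1, hj⟩).is_lt.le hlt'
      ((hsame _ (haR _) _).1 (haR _)).closedIco ?_
    intro p hp h1 h2
    have key : p ∈ R → p = a ⟨j, by omega⟩ := by
      intro hpR
      obtain ⟨i, rfl⟩ := hRa p hpR
      have h1' : (⟨j, by omega⟩ : Fin k) ≤ i := a.le_iff_le.1 h1
      have h2' : i < (⟨j + 1, hj⟩ : Fin k) := a.lt_iff_lt.1 h2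
      rw [Fin.le_def] at h1'
      rw [Fin.lt_def] at h2'
      congr 1
      apply Fin.ext
      dsimp only at h1' h2' ⊢
      omega
    rw [← hfirsts, Finset.mem_insert] at hp
    rcases hp with rfl | hp
    · rcases hz0 with h | h
      · exact key h
      · exact Fin.ext (by omega)
    · exact key (hnlR p hp).1
  obtain ⟨s, hs⟩ : ∃ s : ℕ, s = a ⟨0, by omega⟩ := ⟨_, rfl⟩
  have haj : ∀ j (hj : j < k), (a ⟨j, hj⟩ : ℕ) = s + 4 * j := by
    intro j
    induction j with
    | zero => intro _; exact hs.symm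
    | succ j ih => intro hj; rw [(hblock j hj).1, ih]; ring
  have hT : (a ⟨k - 1, by omega⟩ : ℕ) = s + 4 * (k - 1) := haj _ _
  have hclosed : M.ClosedIco s (s + 4 * (k - 1)) := by
    rw [← hT, hs]
    exact ((hsame _ (haR _) _).1 (haR _)).closedIco
  have hmin : ∀ v ∈ R, s ≤ (v : ℕ) ∧ (v : ℕ) ≤ s + 4 * (k - 1) := by
    intro v hv
    obtain ⟨⟨j, hj⟩, rfl⟩ := hRa v hv
    rw [haj]; omega
  have hzO : ¬ (s ≤ z ∧ (z : ℕ) < s + 4 * (k - 1)) := by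
    rintro ⟨h1, h2⟩
    have hzR : z ∈ R := by
      rcases hz0 with h | h
      · exact h
      · have : z = a ⟨0, by omega⟩ := Fin.ext (by omega)
        rw [this]; exact haR _
    refine hz1 (mem_nonlast.2 ⟨a ⟨k - 1, by omega⟩, ?_, (hsame _ hzR _).1 (haR _)⟩)
    rw [Fin.lt_def, hT]; exact h2
  -- The nonlast arcs all end inside the `k - 1` blocks, so `z` is the only first point outside
  -- them, and what is left is one more crossing pair, possibly wrapped around the root.
  obtain ⟨q, hqS, h1, h2, h3, hall⟩ := exists_crossing_of_unique_first hM.1 hinj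
    (S := {v : Fin n | ¬ (s ≤ v ∧ (v : ℕ) < s + 4 * (k - 1))}) (z := z)
    (fun v hv => hclosed.compl hv) (fun p hp => not_congr (hclosed.crossing_iff hp)) hzO
    (by
      intro p hp hpO
      rw [← hfirsts, Finset.mem_insert] at hp
      rcases hp with rfl | hp
      · rfl
      · obtain ⟨hpR, b, hbR, hpb⟩ := hnlR p hp
        rw [Fin.lt_def] at hpb
        have := hmin p hpR
        have := hmin b hbR
        exact absurd ⟨by omega, by omega⟩ hpO)
    (hsub (Finset.mem_insert_self _ _))
  have hTn : s + 4 * (k - 1) < n := hT ▸ (a ⟨k - 1, by omega⟩).is_lt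
  obtain ⟨e1, e2, e3⟩ := eq_maximalCoreFun_of_outer hTn hzO hqS (hclosed.compl hzO)
    (hclosed.compl hqS) h1 h2 h3 hall
  refine ⟨by omega, s, e2, fun v => ?_⟩
  by_cases hv : s ≤ v ∧ (v : ℕ) < s + 4 * (k - 1)
  · have hj : (v - s : ℕ) / 4 + 1 < k := by omega
    have hb := (hblock _ hj).2 v (by rw [haj]; omega) (by rw [haj]; omega)
    rw [hb, haj, maximalCoreFun, if_pos hv]
    split_ifs <;> omega
  · exact e3 v hv

theorem card_exposed_cross : cross.exposed.card = 1 := by decide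

/-- `k` pairs of crossing chords side by side. -/
def crossPower : (k : ℕ) → PerfectMatching (4 * k)
  | 0 => ⟨fun v => v, fun v => v.elim0⟩
  | k + 1 => (crossPower k).insertAt (Nat.zero_le _) cross

theorem crossPower_isKCore (k : ℕ) : (crossPower k).IsKCore k := by
  induction k with
  | zero => exact ⟨fun v => v.elim0, by decide⟩
  | succ k ih => exact ih.insertAt _ cross_isKCore

theorem card_exposed_crossPower (k : ℕ) : k ≤ (crossPower k).exposed.card := by
  induction k with
  | zero => exact Nat.zero_le _
  | succ k ih =>
    have := card_exposed_insertAt (Nat.zero_le _) (crossPower k) cross (not_isCovered_zero _)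
    rw [card_exposed_cross] at this
    exact le_trans (by omega) this.ge

theorem crossPower_succ_apply_zero (k : ℕ) :
    ((crossPower (k + 1)).1 ⟨0, by omega⟩ : ℕ) = 2 := by
  have h : (⟨0, by omega⟩ : Fin (4 * k + 4)) = insertEquiv (4 * k) 4 0 (Nat.zero_le _) (.inr 0) :=
    Fin.ext (by simp [insertEquiv_inr_val])
  exact (congrArg (fun v => (((crossPower k).insertAt (Nat.zero_le _) cross).1 v : ℕ)) h).trans
    (by rw [insertAt_inr]; rfl)

theorem crossPower_succ_apply_one (k : ℕ) :
    ((crossPower (k + 1)).1 ⟨1, by omega⟩ : ℕ) = 3 := by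
  have h : (⟨1, by omega⟩ : Fin (4 * k + 4)) = insertEquiv (4 * k) 4 0 (Nat.zero_le _) (.inr 1) :=
    Fin.ext (by simp [insertEquiv_inr_val])
  exact (congrArg (fun v => (((crossPower k).insertAt (Nat.zero_le _) cross).1 v : ℕ)) h).trans
    (by rw [insertAt_inr]; rfl)

/-- `k + 1` pairs of crossing chords side by side, rooted at one of the four arcs before a point
of a pair. -/
def rootedCrossPower (k : ℕ) (i : Fin 4) : PerfectMatching (4 + 4 * k) :=
  cross.insertAt i.is_lt.le (crossPower k)

theorem rootedCrossPower_isKCore (k : ℕ) (i : Fin 4) : (rootedCrossPower k i).IsKCore (k + 1) := by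
  have h := cross_isKCore.insertAt i.is_lt.le (crossPower_isKCore k)
  exact ⟨h.1, h.2.trans (add_comm _ _)⟩

/-- The `k + 1` arcs on one region are those ending at the exposed points of the inserted block and
the arc just after the block, which ends at the old point `i`. -/
theorem le_potential_rootedCrossPower {k : ℕ} (hk : 1 ≤ k) (i : Fin 4) :
    2 * (k + 1) - 3 ≤ (rootedCrossPower k i).potential := by
  let e := insertEquiv 4 (4 * k) i i.is_lt.le
  refine le_potential (S := insert (e (.inl i)) ((crossPower k).exposed.map
    (Function.Embedding.inr.trans e.toEmbedding))) (by omega) ?_ ?_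
  · rw [Finset.card_insert_of_notMem, Finset.card_map]
    · have := card_exposed_crossPower k; omega
    · simp
  · have key : ∀ a ∈ insert (e (.inl i)) ((crossPower k).exposed.map
        (Function.Embedding.inr.trans e.toEmbedding)),
        (rootedCrossPower k i).SameRegion (e (.inl i)) a := by
      intro a ha
      rcases Finset.mem_insert.1 ha with rfl | ha
      · exact SameRegion.refl _ _
      · obtain ⟨u, hu, rfl⟩ := Finset.mem_map.1 ha
        unfold SameRegion
        rw [forall_fin_insert i.is_lt.le]
        constructor
        · intro x _
          simp [rootedCrossPower, e]
        · intro y _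
          have h1 : ¬ (y < u ∧ u ≤ (crossPower k).1 y) := fun h => (mem_exposed.1 hu).2
            (isCovered_val.2 ⟨y, (crossPower_isKCore k).1 y, h⟩)
          simp [rootedCrossPower, e] at h1 ⊢
          exact h1
    exact fun a ha b hb => (key a ha).symm.trans (key b hb)

theorem rootedCrossPower_apply_zero (k : ℕ) (i : Fin 4) :
    ((rootedCrossPower (k + 1) i).1 ⟨0, by omega⟩ : ℕ) =
      if i = 0 ∨ i = 3 then 2 else 2 + 4 * (k + 1) := by
  by_cases hi : i = 0
  · subst hi
    have h : (⟨0, by omega⟩ : Fin (4 + 4 * (k + 1))) =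
        insertEquiv 4 (4 * (k + 1)) (0 : Fin 4) (by simp) (.inr ⟨0, by omega⟩) :=
      Fin.ext (by simp [insertEquiv_inr_val])
    rw [h, rootedCrossPower, insertAt_inr, insertEquiv_inr_val, crossPower_succ_apply_zero]
    simp
  · have h : (⟨0, by omega⟩ : Fin (4 + 4 * (k + 1))) =
        insertEquiv 4 (4 * (k + 1)) i i.is_lt.le (.inl 0) :=
      Fin.ext (by simp [insertEquiv_inl_val, hi])
    have e0 : cross.1 0 = 2 := rfl
    rw [h, rootedCrossPower, insertAt_inl, insertEquiv_inl_val, e0]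
    have : (i : ℕ) ≠ 0 := fun h => hi (Fin.ext h)
    simp only [hi, false_or, Fin.ext_iff]
    have h2 : ((2 : Fin 4) : ℕ) = 2 := rfl
    have h3 : ((3 : Fin 4) : ℕ) = 3 := rfl
    rw [h2, h3]
    split_ifs <;> omega

theorem rootedCrossPower_apply_one (k : ℕ) (i : Fin 4) :
    ((rootedCrossPower (k + 1) i).1 ⟨1, by omega⟩ : ℕ) =
      if (i : ℕ) < 2 then 3 else 3 + 4 * (k + 1) := by
  by_cases hi : (i : ℕ) < 2
  · rw [if_pos hi]
    have h : (⟨1, by omega⟩ : Fin (4 + 4 * (k + 1))) =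
        insertEquiv 4 (4 * (k + 1)) i i.is_lt.le (.inr ⟨1 - i, by omega⟩) :=
      Fin.ext (by rw [insertEquiv_inr_val]; dsimp only; omega)
    rw [h, rootedCrossPower, insertAt_inr, insertEquiv_inr_val]
    have h01 : (i : ℕ) = 0 ∨ (i : ℕ) = 1 := by omega
    rcases h01 with h | h <;> simp only [h]
    · rw [crossPower_succ_apply_one]
    · rw [crossPower_succ_apply_zero]
  · rw [if_neg hi]
    have h : (⟨1, by omega⟩ : Fin (4 + 4 * (k + 1))) =
        insertEquiv 4 (4 * (k + 1)) i i.is_lt.le (.inl 1) :=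
      Fin.ext (by
        have h1 : ((1 : Fin 4) : ℕ) = 1 := rfl
        rw [insertEquiv_inl_val, h1, if_pos (by omega)])
    have e1 : cross.1 1 = 3 := rfl
    have h3 : ((3 : Fin 4) : ℕ) = 3 := rfl
    rw [h, rootedCrossPower, insertAt_inl, insertEquiv_inl_val, e1, h3, if_neg (by omega)]

/-- The partners of points `0` and `1` already tell the four rootings apart; this needs a nonempty
inserted block, hence the index `k + 1`. -/
theorem rootedCrossPower_injective (k : ℕ) : Function.Injective (rootedCrossPower (k + 1)) := by
  intro i j h
  have h0 := rootedCrossPower_apply_zero k i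
  have h1 := rootedCrossPower_apply_one k i
  rw [h, rootedCrossPower_apply_zero] at h0
  rw [h, rootedCrossPower_apply_one] at h1
  have e3 : ((3 : Fin 4) : ℕ) = 3 := rfl
  have e0 : ((0 : Fin 4) : ℕ) = 0 := rfl
  simp only [Fin.ext_iff, e3, e0] at h0
  apply Fin.ext
  split_ifs at h0 h1 <;> omega

theorem IsMaximalKCore.eq_maximalCoreFun {k : ℕ} (hk : 1 ≤ k) {M : PerfectMatching n}
    (hM : M.IsMaximalKCore k) :
    n = 4 * k ∧ ∃ s < 4, ∀ v : Fin n, (M.1 v : ℕ) = maximalCoreFun k s v := by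
  rcases hk.eq_or_lt with rfl | hk2
  · exact hM.1.eq_maximalCoreFun_of_one
  · obtain ⟨k, rfl⟩ : ∃ l, k = l + 1 := ⟨k - 1, by omega⟩
    exact hM.1.eq_maximalCoreFun hk2 ((le_potential_rootedCrossPower (by omega) 0).trans
      (hM.2 _ _ (rootedCrossPower_isKCore k 0)))

theorem sigma_ext_of_eq_maximalCoreFun {k s : ℕ} {K K' : Σ n : ℕ, PerfectMatching n}
    (h : K.1 = 4 * k) (h' : K'.1 = 4 * k) (hs : ∀ v, (K.2.1 v : ℕ) = maximalCoreFun k s v)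
    (hs' : ∀ v, (K'.2.1 v : ℕ) = maximalCoreFun k s v) : K = K' := by
  obtain ⟨n, M⟩ := K
  obtain ⟨n', M'⟩ := K'
  dsimp only at h h' hs hs'
  subst h h'
  congr 1
  exact Subtype.ext (funext fun v => Fin.ext ((hs v).trans (hs' v).symm))

theorem ncard_setOf_isMaximalKCore_one :
    Set.ncard {K : Σ n : ℕ, PerfectMatching n | K.2.IsMaximalKCore 1} = 1 := by
  rw [Set.ncard_eq_one]
  refine ⟨⟨4, cross⟩, Set.eq_singleton_iff_unique_mem.2 ⟨?_, ?_⟩⟩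
  · exact cross_isKCore.isMaximalKCore le_rfl (by simp)
  · rintro ⟨n, M⟩ hM
    have hn := (IsMaximalKCore.eq_maximalCoreFun le_rfl hM).1
    have hn' : n = 4 := hn
    subst hn'
    congr 1
    have h : ∀ M : PerfectMatching 4, M.IsKCore 1 → M = cross := by
      intro M hM
      obtain ⟨p, hp⟩ : M.crossings.Nonempty := Finset.card_pos.1 (by rw [hM.2]; omega)
      have hc := mem_crossings.1 hp
      have e1 := M.involutive p.1
      have e2 := M.involutive p.2
      have h1 : p.1 = 0 := by omega
      have h2 : p.2 = 1 := by omega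
      have h3 : M.1 p.1 = 2 := by omega
      have h4 : M.1 p.2 = 3 := by omega
      rw [h3, h1] at e1
      rw [h4, h2] at e2
      rw [h1] at h3
      rw [h2] at h4
      refine Subtype.ext (funext fun v => ?_)
      fin_cases v
      · exact h3
      · exact h4
      · exact e1
      · exact e2
    exact h M hM.1

/-- At most four because the parameter `s < 4` determines the core, at least four by the distinct
rootings `rootedCrossPower`. -/
theorem ncard_setOf_isMaximalKCore {k : ℕ} (hk : 2 ≤ k) :
    Set.ncard {K : Σ n : ℕ, PerfectMatching n | K.2.IsMaximalKCore k} = 4 := by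
  have hdata : ∀ K : Σ n : ℕ, PerfectMatching n, ∃ s, K.2.IsMaximalKCore k → K.1 = 4 * k ∧
      s < 4 ∧ ∀ v, (K.2.1 v : ℕ) = maximalCoreFun k s v := by
    intro K
    by_cases hK : K.2.IsMaximalKCore k
    · obtain ⟨h1, s, h2, h3⟩ := hK.eq_maximalCoreFun (by omega)
      exact ⟨s, fun _ => ⟨h1, h2, h3⟩⟩
    · exact ⟨0, fun h => absurd h hK⟩
  choose f hf using hdata
  have hinj : Set.InjOn f {K : Σ n : ℕ, PerfectMatching n | K.2.IsMaximalKCore k} := by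
    intro K hK K' hK' h
    obtain ⟨h1, -, h3⟩ := hf K hK
    obtain ⟨h1', -, h3'⟩ := hf K' hK'
    rw [← h] at h3'
    exact sigma_ext_of_eq_maximalCoreFun h1 h1' h3 h3'
  have hmaps : ∀ K ∈ {K : Σ n : ℕ, PerfectMatching n | K.2.IsMaximalKCore k},
      f K ∈ (Finset.range 4 : Set ℕ) := fun K hK => by
    rw [Finset.mem_coe, Finset.mem_range]; exact (hf K hK).2.1
  have hfin : {K : Σ n : ℕ, PerfectMatching n | K.2.IsMaximalKCore k}.Finite :=
    Set.Finite.of_injOn hmaps hinj (Finset.finite_toSet _)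
  refine le_antisymm ?_ ?_
  · refine (Set.ncard_le_ncard_of_injOn f hmaps hinj (Finset.finite_toSet _)).trans ?_
    rw [Set.ncard_coe_finset, Finset.card_range]
  · obtain ⟨k, rfl⟩ : ∃ l, k = l + 2 := ⟨k - 2, by omega⟩
    let g : Fin 4 → Σ n : ℕ, PerfectMatching n := fun i => ⟨_, rootedCrossPower (k + 1) i⟩
    have hg : Function.Injective g := fun i j h =>
      rootedCrossPower_injective k (eq_of_heq (Sigma.mk.inj h).2)
    have h4 : (Set.range g).ncard = 4 := by
      rw [← Set.image_univ, Set.ncard_image_of_injective _ hg, Set.ncard_univ, Nat.card_fin]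
    rw [← h4]
    refine Set.ncard_le_ncard ?_ hfin
    rintro _ ⟨i, rfl⟩
    exact (rootedCrossPower_isKCore (k + 1) i).isMaximalKCore (by omega)
      (le_potential_rootedCrossPower (by omega) i)

end PerfectMatching

/-! ### Asymptotics of both bounds -/

section Asymptotics
open Filter Topology

theorem centralBinom_eq_stirlingSeq {m : ℕ} (hm : m ≠ 0) :
    (m.centralBinom : ℝ) / 4 ^ m * √m = Stirling.stirlingSeq (2 * m) / Stirling.stirlingSeq m ^ 2 := by
  have hm' : (0 : ℝ) < m := by exact_mod_cast Nat.pos_of_ne_zero hm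
  have h1 : (m.centralBinom : ℝ) = ((2 * m).factorial : ℝ) / (m.factorial : ℝ) ^ 2 := by
    rw [Nat.centralBinom_eq_two_mul_choose, Nat.cast_choose ℝ (by omega : m ≤ 2 * m),
      show 2 * m - m = m by omega, sq]
  have h2 : √(2 * ((2 * m : ℕ) : ℝ)) = 2 * √m := by
    rw [show (2 * ((2 * m : ℕ) : ℝ)) = 2 ^ 2 * m by push_cast; ring,
      Real.sqrt_mul (by positivity), Real.sqrt_sq (by norm_num)]
  have h3 : √(2 * (m : ℝ)) ^ 2 = 2 * m := Real.sq_sqrt (by positivity)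
  have h4 : √(m : ℝ) ^ 2 = m := Real.sq_sqrt (by positivity)
  have h5 : (((2 * m : ℕ) : ℝ) / Real.exp 1) ^ (2 * m) =
      4 ^ m * (((m : ℝ) / Real.exp 1) ^ m) ^ 2 := by
    rw [← pow_mul, mul_comm m 2, show (((2 * m : ℕ) : ℝ) / Real.exp 1) = 2 * (m / Real.exp 1) by
      push_cast; ring, mul_pow, pow_mul 2 2 m]
    norm_num
  have hE : ((m : ℝ) / Real.exp 1) ^ m ≠ 0 := by positivity
  have hs : √(m : ℝ) ≠ 0 := by positivity
  have hf : (m.factorial : ℝ) ≠ 0 := by positivity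
  rw [Stirling.stirlingSeq, Stirling.stirlingSeq, h1, h2, h5]
  generalize ((m : ℝ) / Real.exp 1) ^ m = E at *
  rw [div_pow, mul_pow, h3]
  field_simp
  rw [h4]

theorem tendsto_centralBinom :
    Tendsto (fun m : ℕ => (m.centralBinom : ℝ) / 4 ^ m * √m) atTop (𝓝 (1 / √Real.pi)) := by
  have h := Stirling.tendsto_stirlingSeq_sqrt_pi
  have h2 : Tendsto (fun m : ℕ => Stirling.stirlingSeq (2 * m)) atTop (𝓝 (√Real.pi)) :=
    h.comp (tendsto_id.const_mul_atTop' (by norm_num))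
  have hpi : √Real.pi ≠ 0 := by positivity
  have h3 := h2.div (h.pow 2) (by positivity)
  rw [show √Real.pi / √Real.pi ^ 2 = 1 / √Real.pi by field_simp] at h3
  refine h3.congr' ?_
  filter_upwards [eventually_ne_atTop 0] with m hm
  exact (centralBinom_eq_stirlingSeq hm).symm

theorem tendsto_catalan :
    Tendsto (fun m : ℕ => (catalan m : ℝ) / (4 ^ m * (m : ℝ) ^ (-(3 / 2) : ℝ))) atTop
      (𝓝 (1 / √Real.pi)) := by
  have h := tendsto_centralBinom.mul (tendsto_natCast_div_add_atTop (1 : ℝ))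
  rw [mul_one] at h
  refine h.congr' ?_
  filter_upwards [eventually_ne_atTop 0] with m hm
  have hm' : (0 : ℝ) < m := by exact_mod_cast Nat.pos_of_ne_zero hm
  have h1 : ((m : ℝ) + 1) * catalan m = m.centralBinom := by
    exact_mod_cast succ_mul_catalan_eq_centralBinom m
  have h2 : (m : ℝ) ^ (-(3 / 2) : ℝ) = 1 / (√m * m) := by
    rw [Real.rpow_neg hm'.le, show (3 / 2 : ℝ) = 1 / 2 + 1 by norm_num, Real.rpow_add_one hm'.ne',
      ← Real.sqrt_eq_rpow, one_div]
  rw [h2, ← h1]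
  have hs : √(m : ℝ) ≠ 0 := by positivity
  field_simp

/-- The closed form makes the sum telescope; since `centralBinom L / 4 ^ L` tends to `0`, the
Catalan generating function takes the value `2` at `1 / 4`. -/
theorem sum_catalan_div (L : ℕ) :
    ∑ a ∈ Finset.range L, (catalan a : ℝ) / 4 ^ a = 2 * (1 - (L.centralBinom : ℝ) / 4 ^ L) := by
  induction L with
  | zero => simp
  | succ L ih =>
    rw [Finset.sum_range_succ, ih]
    have h1 : ((L : ℝ) + 1) * catalan L = L.centralBinom := by
      exact_mod_cast succ_mul_catalan_eq_centralBinom L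
    have h2 : ((L : ℝ) + 1) * (L + 1).centralBinom = 2 * (2 * L + 1) * L.centralBinom := by
      exact_mod_cast Nat.succ_mul_centralBinom_succ L
    have h3 : ((L + 1).centralBinom : ℝ) = 2 * (2 * L + 1) * catalan L := by
      have : (0 : ℝ) < L + 1 := by positivity
      rw [← h1] at h2
      exact mul_left_cancel₀ this.ne' (by rw [h2]; ring)
    rw [h3, ← h1, pow_succ]
    field_simp
    ring

theorem tendsto_sum_catalan_div :
    Tendsto (fun L : ℕ => ∑ a ∈ Finset.range L, (catalan a : ℝ) / 4 ^ a) atTop (𝓝 2) := by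
  simp only [sum_catalan_div]
  have h1 : Tendsto (fun m : ℕ => (√(m : ℝ))⁻¹) atTop (𝓝 0) :=
    (Real.tendsto_sqrt_atTop.comp tendsto_natCast_atTop_atTop).inv_tendsto_atTop
  have h2 := tendsto_centralBinom.mul h1
  rw [mul_zero] at h2
  have h3 : Tendsto (fun m : ℕ => (m.centralBinom : ℝ) / 4 ^ m) atTop (𝓝 0) := by
    refine h2.congr' ?_
    filter_upwards [eventually_ne_atTop 0] with m hm
    have hm' : (0 : ℝ) < m := by exact_mod_cast Nat.pos_of_ne_zero hm
    have hs : √(m : ℝ) ≠ 0 := by positivity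
    field_simp
  simpa using (h3.const_sub 1).const_mul 2

/-- The order of growth of the number of matchings with `k` crossings. -/
noncomputable def growth (k m : ℕ) : ℝ := 4 ^ m * (m : ℝ) ^ ((k : ℝ) - 3 / 2)

theorem growth_pos (k : ℕ) {m : ℕ} (hm : m ≠ 0) : 0 < growth k m := by
  have hm' : (0 : ℝ) < m := by exact_mod_cast Nat.pos_of_ne_zero hm
  unfold growth
  positivity

theorem growth_succ (k : ℕ) {m : ℕ} (hm : m ≠ 0) : growth (k + 1) m = growth k m * m := by
  have hm' : (m : ℝ) ≠ 0 := by exact_mod_cast hm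
  rw [growth, growth, mul_assoc, ← Real.rpow_add_one hm']
  congr 2
  push_cast
  ring

theorem growth_eq_mul_pow (k : ℕ) {m : ℕ} (hm : m ≠ 0) :
    growth k m = 4 ^ m * (m : ℝ) ^ (-(3 / 2) : ℝ) * (m : ℝ) ^ k := by
  induction k with
  | zero => simp [growth]
  | succ k ih => rw [growth_succ k hm, ih, pow_succ]; ring

theorem tendsto_natCast_sub_div (j : ℕ) :
    Tendsto (fun m : ℕ => ((m - j : ℕ) : ℝ) / m) atTop (𝓝 1) := by
  have h : Tendsto (fun m : ℕ => 1 - (j : ℝ) / m) atTop (𝓝 1) := by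
    simpa using (tendsto_const_div_atTop_nhds_zero_nat (j : ℝ)).const_sub 1
  refine h.congr' ?_
  filter_upwards [eventually_ge_atTop j, eventually_ne_atTop 0] with m hj hm
  have hm' : (m : ℝ) ≠ 0 := by exact_mod_cast hm
  rw [Nat.cast_sub hj]
  field_simp

theorem tendsto_growth_sub_div (k j : ℕ) :
    Tendsto (fun m : ℕ => growth k (m - j) / growth k m) atTop (𝓝 ((1 / 4) ^ j)) := by
  have h := ((tendsto_natCast_sub_div j).rpow_const (p := (k : ℝ) - 3 / 2)
    (Or.inl one_ne_zero)).const_mul ((1 / 4 : ℝ) ^ j)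
  rw [Real.one_rpow, mul_one] at h
  refine h.congr' ?_
  filter_upwards [eventually_ge_atTop j, eventually_ne_atTop 0] with m hj hm
  have hm' : (0 : ℝ) < m := by exact_mod_cast Nat.pos_of_ne_zero hm
  rw [growth, growth, Real.div_rpow (by positivity) (by positivity)]
  have h4 : (4 : ℝ) ^ m = 4 ^ (m - j) * 4 ^ j := by rw [← pow_add]; congr 1; omega
  rw [h4, one_div, inv_pow]
  have := (Real.rpow_pos_of_pos hm' ((k : ℝ) - 3 / 2)).ne'
  field_simp

theorem tendsto_two_mul_sub_div (j d : ℕ) :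
    Tendsto (fun m : ℕ => ((2 * (m - j) - d : ℕ) : ℝ) / m) atTop (𝓝 2) := by
  have h := ((tendsto_natCast_sub_div j).const_mul 2).sub
    (tendsto_const_div_atTop_nhds_zero_nat (d : ℝ))
  rw [mul_one, sub_zero] at h
  refine h.congr' ?_
  filter_upwards [eventually_ge_atTop (j + d)] with m hm
  rw [Nat.cast_sub (show d ≤ 2 * (m - j) by omega), Nat.cast_mul]
  push_cast
  ring

/-- The factor by which each crossing multiplies the lower bound built from blobs with fewer than
`L` chords in each of their arcs. -/
noncomputable def blobWeight (L : ℕ) : ℝ :=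
  (∑ a ∈ Finset.range L, (catalan a : ℝ) / 4 ^ a) ^ 3 / 8

theorem tendsto_blobWeight : Tendsto blobWeight atTop (𝓝 1) := by
  have := (tendsto_sum_catalan_div.pow 3).div_const 8
  norm_num at this
  exact this

theorem blobWeight_eq_sum (L : ℕ) :
    blobWeight L = ∑ t ∈ Finset.range L ×ˢ Finset.range L ×ˢ Finset.range L,
      (catalan t.1 * (catalan t.2.1 * catalan t.2.2) : ℝ) * 
        (2 * (1 / 4) ^ (2 + t.1 + t.2.1 + t.2.2)) := by
  have h : ∀ t : ℕ × ℕ × ℕ, (catalan t.1 * (catalan t.2.1 * catalan t.2.2) : ℝ) *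
      (2 * (1 / 4) ^ (2 + t.1 + t.2.1 + t.2.2)) = (catalan t.1 : ℝ) / 4 ^ t.1 *
        ((catalan t.2.1 : ℝ) / 4 ^ t.2.1 * ((catalan t.2.2 : ℝ) / 4 ^ t.2.2)) * (1 / 8) := by
    intro t
    rw [pow_add, pow_add, pow_add]
    simp only [one_div, inv_pow]
    field_simp
    ring
  rw [Finset.sum_congr rfl fun t _ => h t, ← Finset.sum_mul, Finset.sum_product]
  simp_rw [Finset.sum_product, ← Finset.mul_sum]
  rw [← Finset.sum_mul, ← Finset.sum_mul, blobWeight]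
  ring

-- For fixed `L`, the insertion inequality is iterated on explicit minorants `f` that have a limit
-- after division by `growth`, so that no limit inferior is needed. Each step contributes a factor
-- `blobWeight L / (k + 1)`.
open PerfectMatching in
theorem exists_lower_bound (L k : ℕ) : ∃ f : ℕ → ℝ,
    (∀ᶠ m in atTop, f m ≤ ((spread (6 * L + 4) k (2 * m)).card : ℝ)) ∧
      Tendsto (fun m => f m / growth k m) atTop
        (𝓝 (blobWeight L ^ k / (k.factorial * √Real.pi))) := by
  induction k with
  | zero =>
    refine ⟨fun m => catalan m, Eventually.of_forall fun m => ?_, ?_⟩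
    · exact Nat.cast_le.2 (catalan_le_card_spread_zero _ m)
    · simpa [growth] using tendsto_catalan
  | succ k ih =>
    obtain ⟨f, hf, hlim⟩ := ih
    let T := Finset.range L ×ˢ Finset.range L ×ˢ Finset.range L
    let j : ℕ × ℕ × ℕ → ℕ := fun t => 2 + t.1 + t.2.1 + t.2.2
    let w : ℕ × ℕ × ℕ → ℝ := fun t => catalan t.1 * (catalan t.2.1 * catalan t.2.2)
    have hw : ∀ t, 0 ≤ w t := fun t => by positivity
    -- The inequality `sum_mul_card_spread_le` with `f` in place of the number of spread matchings;
    -- `j t` is the number of chords of a blob.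
    refine ⟨fun m => (∑ t ∈ T, w t * (((2 * (m - j t) - (6 * L + 4) * k : ℕ) : ℝ) *
      f (m - j t))) / (k + 1), ?_, ?_⟩
    · have hall : ∀ᶠ m in atTop, ∀ t ∈ T,
          f (m - j t) ≤ ((spread (6 * L + 4) k (2 * (m - j t))).card : ℝ) := by
        rw [Filter.eventually_all_finset]
        exact fun t _ => (tendsto_sub_atTop_nat (j t)).eventually hf
      filter_upwards [hall, eventually_ge_atTop (3 * L + 2)] with m hm hmL
      rw [div_le_iff₀ (by positivity)]
      have h := sum_mul_card_spread_le L k m hmL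
      have h' := (Nat.cast_le (α := ℝ)).2 h
      simp only [Nat.cast_sum, Nat.cast_mul, Nat.cast_add, Nat.cast_one] at h'
      rw [mul_comm ((k : ℝ) + 1)] at h'
      refine le_trans (Finset.sum_le_sum fun t ht => ?_) h'
      exact mul_le_mul_of_nonneg_left
        (mul_le_mul_of_nonneg_left (hm t ht) (Nat.cast_nonneg _)) (hw t)
    · have hterm : ∀ t ∈ T, Tendsto (fun m : ℕ =>
          w t * ((((2 * (m - j t) - (6 * L + 4) * k : ℕ) : ℝ) / m) *
            (f (m - j t) / growth k (m - j t)) * (growth k (m - j t) / growth k m))) atTop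
          (𝓝 (w t * (2 * (blobWeight L ^ k / (k.factorial * √Real.pi)) * (1 / 4) ^ (j t)))) :=
        fun t _ => (((tendsto_two_mul_sub_div (j t) ((6 * L + 4) * k)).mul
          (hlim.comp (tendsto_sub_atTop_nat (j t)))).mul
            (tendsto_growth_sub_div k (j t))).const_mul (w t)
      have hsum := (tendsto_finsetSum T hterm).div_const ((k : ℝ) + 1)
      have hval : (∑ t ∈ T, w t * (2 * (blobWeight L ^ k / (k.factorial * √Real.pi)) *
          (1 / 4) ^ (j t))) / ((k : ℝ) + 1) =
          blobWeight L ^ (k + 1) / ((k + 1).factorial * √Real.pi) := by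
        have hc : ∀ c : ℝ, ∑ t ∈ T, w t * (2 * c * (1 / 4) ^ (j t)) = blobWeight L * c := by
          intro c
          rw [blobWeight_eq_sum, Finset.sum_mul]
          exact Finset.sum_congr rfl fun t _ => by ring
        rw [hc, pow_succ, Nat.factorial_succ]
        push_cast
        field_simp
      rw [hval] at hsum
      refine hsum.congr' ?_
      have hbig : ∀ᶠ m : ℕ in atTop, ∀ t ∈ T, m - j t ≠ 0 := by
        rw [Filter.eventually_all_finset]
        exact fun t _ => (tendsto_sub_atTop_nat (j t)).eventually (eventually_ne_atTop 0)
      filter_upwards [hbig, eventually_ne_atTop 0] with m hm hm0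
      rw [div_right_comm _ ((k : ℝ) + 1) (growth (k + 1) m),
        Finset.sum_div T _ (growth (k + 1) m)]
      congr 1
      refine Finset.sum_congr rfl fun t ht => ?_
      have h1 := (growth_pos k (hm t ht)).ne'
      have h2 := (growth_pos k hm0).ne'
      have hm' : (m : ℝ) ≠ 0 := by exact_mod_cast hm0
      rw [growth_succ k hm0]
      field_simp

theorem tendsto_upper_bound {k : ℕ} (hk : 1 ≤ k) :
    Tendsto (fun m : ℕ => ((catalan m * (m + k - 1).choose k : ℕ) : ℝ) / growth k m) atTop
      (𝓝 (1 / (k.factorial * √Real.pi))) := by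
  obtain ⟨k, rfl⟩ : ∃ l, k = l + 1 := ⟨k - 1, by omega⟩
  have h1 : Tendsto (fun m : ℕ => ((m + k : ℕ) : ℝ) / m) atTop (𝓝 1) := by
    have h : Tendsto (fun m : ℕ => 1 + (k : ℝ) / m) atTop (𝓝 1) := by
      simpa using (tendsto_const_div_atTop_nhds_zero_nat (k : ℝ)).const_add 1
    refine h.congr' ?_
    filter_upwards [eventually_ne_atTop 0] with m hm
    have hm' : (m : ℝ) ≠ 0 := by exact_mod_cast hm
    push_cast
    field_simp
  have h2 : Tendsto (fun n : ℕ => (n.choose (k + 1) : ℝ) / ((n : ℝ) ^ (k + 1) / (k + 1).factorial))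
      atTop (𝓝 1) := by
    refine (Asymptotics.isEquivalent_iff_tendsto_one ?_).1 (isEquivalent_choose (k + 1))
    filter_upwards [eventually_ne_atTop 0] with n hn
    have hn' : (n : ℝ) ≠ 0 := by exact_mod_cast hn
    positivity
  have h3 := ((h2.comp (tendsto_add_atTop_nat k)).mul (h1.pow (k + 1))).div_const
    ((k + 1).factorial : ℝ)
  have h4 := tendsto_catalan.mul h3
  have hval : 1 / √Real.pi * (1 * 1 ^ (k + 1) / ((k + 1).factorial : ℝ)) =
      1 / ((k + 1).factorial * √Real.pi) := by
    rw [one_pow]; field_simp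
  rw [hval] at h4
  refine h4.congr' ?_
  filter_upwards [eventually_ne_atTop 0] with m hm
  have hm' : (0 : ℝ) < m := by exact_mod_cast Nat.pos_of_ne_zero hm
  have hmk : ((m + k : ℕ) : ℝ) ≠ 0 := by positivity
  rw [growth_eq_mul_pow _ hm, ← add_assoc, Nat.add_sub_cancel]
  have h5 := (Real.rpow_pos_of_pos hm' (-(3 / 2))).ne'
  simp only [Function.comp_apply, Nat.cast_mul]
  rw [div_pow]
  field_simp

/-- The limit in `m` is taken for fixed `L`, and only then is `L` chosen large enough that
`blobWeight L ^ k` is near `1`. A general `f` between the two counts treats both of them at once. -/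
theorem tendsto_div_growth {k : ℕ} (hk : 1 ≤ k) {f : ℕ → ℕ}
    (h1 : ∀ m, numMatchingsMaximalCore k (2 * m) ≤ f m) (h2 : ∀ m, f m ≤ numMatchings k (2 * m)) :
    Tendsto (fun m => (f m : ℝ) / growth k m) atTop (𝓝 (1 / (k.factorial * √Real.pi))) := by
  rw [tendsto_order]
  constructor
  · intro c hc
    have hw : Tendsto (fun L => blobWeight L ^ k / (k.factorial * √Real.pi)) atTop
        (𝓝 (1 / (k.factorial * √Real.pi))) := by
      simpa using (tendsto_blobWeight.pow k).div_const (k.factorial * √Real.pi)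
    obtain ⟨L, hL⟩ := ((tendsto_order.1 hw).1 c hc).exists
    obtain ⟨g, hg, hlim⟩ := exists_lower_bound L k
    filter_upwards [hg, (tendsto_order.1 hlim).1 c hL, eventually_ne_atTop 0] with m hm hm2 hm0
    have hpos := growth_pos k hm0
    refine hm2.trans_le (div_le_div_of_nonneg_right (hm.trans ?_) hpos.le)
    exact_mod_cast (card_spread_le hk _ _).trans (h1 m)
  · intro c hc
    filter_upwards [(tendsto_order.1 (tendsto_upper_bound hk)).2 c hc, eventually_ne_atTop 0]
      with m hm hm0
    have hpos := growth_pos k hm0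
    refine lt_of_le_of_lt (div_le_div_of_nonneg_right ?_ hpos.le) hm
    exact_mod_cast (h2 m).trans (numMatchings_le k m)

theorem isEquivalent_growth {k : ℕ} (hk : 1 ≤ k) {f : ℕ → ℕ}
    (h1 : ∀ m, numMatchingsMaximalCore k (2 * m) ≤ f m) (h2 : ∀ m, f m ≤ numMatchings k (2 * m)) :
    Asymptotics.IsEquivalent atTop (fun m => (f m : ℝ))
      fun m => 1 / (k.factorial * √Real.pi) * growth k m := by
  have hc : 1 / (k.factorial * √Real.pi) ≠ 0 := by positivity
  apply Asymptotics.isEquivalent_of_tendsto_one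
  have h := (tendsto_div_growth hk h1 h2).div_const (1 / (k.factorial * √Real.pi))
  rw [div_self hc] at h
  refine h.congr fun m => ?_
  simp only [Pi.div_apply]
  rw [div_div, mul_comm]

end Asymptotics

open Filter Asymptotics Nat in
/-- For `k = 1` the truncated `2 * k - 3` is `0` and `0‼ = 1` is the convention `(-1)!! = 1`. -/
theorem mainTheorem2 (k : ℕ) (hk : 1 ≤ k) :
    ((fun m : ℕ => (numMatchings k (2 * m) : ℝ)) ~[atTop]
      fun m : ℕ =>
        ((2 * k - 3)‼ : ℝ) / (2 ^ (k - 1) * (k ! : ℝ) * Real.Gamma ((k : ℝ) - 1 / 2)) *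
          (m : ℝ) ^ ((k : ℝ) - 3 / 2) * 4 ^ m) ∧
    ((fun m : ℕ => (numMatchingsMaximalCore k (2 * m) : ℝ)) ~[atTop]
      fun m : ℕ => (numMatchings k (2 * m) : ℝ)) ∧
    Set.ncard {K : Σ n : ℕ, PerfectMatching n | K.2.IsMaximalKCore k} =
      (if k = 1 then 1 else 4) := by
  have hnum := isEquivalent_growth hk (f := fun m => numMatchings k (2 * m))
    (fun m => numMatchingsMaximalCore_le k (2 * m)) fun _ => le_rfl
  have hmax := isEquivalent_growth hk (f := fun m => numMatchingsMaximalCore k (2 * m))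
    (fun _ => le_rfl) fun m => numMatchingsMaximalCore_le k (2 * m)
  refine ⟨?_, hmax.trans hnum.symm, ?_⟩
  · obtain ⟨k, rfl⟩ : ∃ l, k = l + 1 := ⟨k - 1, by omega⟩
    -- The double factorial and the power of two in the stated constant cancel against this
    -- half-integer value of the Gamma function, leaving `1 / (k! * √π)` for the original `k`.
    have hG : Real.Gamma (((k + 1 : ℕ) : ℝ) - 1 / 2) = (2 * k - 1 : ℕ)‼ * √Real.pi / 2 ^ k := by
      rw [← Real.Gamma_nat_add_half]
      congr 1
      push_cast
      ring
    have hd : ((2 * (k + 1) - 3)‼ : ℝ) ≠ 0 := by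
      exact_mod_cast (Nat.doubleFactorial_pos _).ne'
    have hconst : ((2 * (k + 1) - 3)‼ : ℝ) /
        (2 ^ (k + 1 - 1) * ((k + 1)! : ℝ) * Real.Gamma (((k + 1 : ℕ) : ℝ) - 1 / 2)) =
        1 / ((k + 1)! * √Real.pi) := by
      rw [hG, show 2 * (k + 1) - 3 = 2 * k - 1 by omega] at *
      rw [Nat.add_sub_cancel]
      field_simp
    rw [hconst]
    convert hnum using 2 with m
    rw [growth]
    ring
  · split_ifs with h
    · subst h
      exact PerfectMatching.ncard_setOf_isMaximalKCore_one
    · exact PerfectMatching.ncard_setOf_isMaximalKCore (by omega)
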